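/- Let $R$ be a two-dimensional complete regular local ring with field of fractions $F$, residue field $k$ of characteristic different from $2$, and maximal ideal $\mathfrak m=(\pi,\delta)$. For nonzero $a,b\in R$ let $R(a,b)$ be the $R$-algebra generated by $i,j$ with relations $i^2=a$, $j^2=b$, $ij=-ji$, and let $(a,b)$ be the quaternion algebra over $F$ with the same generators and relations. Let $u,v\in R$ be units, and let $(D_1,\Gamma_1)$ be one of the following: (i) $D_1=(u,v)$, $\Gamma_1=R(u,v)$; (ii) $D_1=(u,\pi)$, $\Gamma_1=R(u,\pi)$; (iii) $D_1=(\pi,\delta)$, $\Gamma_1=R(\pi,\delta)$; (iv) $D_1=(u,\pi\delta)$, $\Gamma_1=R(u,\pi\delta)$; (v) $D_1=(u,\pi)\otimes_F(v,\delta)$, $\Gamma_1=R(u,\pi)\otimes_R R(v,\delta)$. Let $\Gamma_0$ be an Azumaya $R$-algebra and $D_0=\Gamma_0\otimes_R F$. If $D_0\otimes_F D_1$ is a division algebra, then $\Gamma_0\otimes_R\Gamma_1$ is a maximal $R$-order of $D_0\otimes_F D_1$; that is, the canonical map $\Gamma_0\otimes_R\Gamma_1\to D_0\otimes_F D_1$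 is injective, and its image is maximal under inclusion among the subrings of $D_0\otimes_F D_1$ that contain the image of $R$, are finitely generated as $R$-modules, and span $D_0\otimes_F D_1$ over $F$. -/

import Mathlib

open scoped TensorProduct Quaternion

namespace MaxOrd

/-- A ring is a division ring: it is non-trivial and each nonzero element is invertible. -/
def IsDivision (D : Type*) [Ring D] : Prop :=
  Nontrivial D ∧ ∀ x : D, x ≠ 0 → IsUnit x

/-- An `R`-order in the `F`-algebra `D`, where `F` is the field of fractions of `R`: an
`R`-subalgebra which is finitely generated as an `R`-module and which spans `D` over `F`. -/
structure IsOrderIn (R F : Type*) {D : Type*} [CommRing R] [Field F] [Ring D] [Algebra R D]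
    [Algebra F D] (Λ : Subalgebra R D) : Prop where
  finite : (Subalgebra.toSubmodule Λ).FG
  span_eq_top : Submodule.span F (Λ : Set D) = ⊤

/-- A maximal `R`-order in `D`: an `R`-order that is not properly contained in another one. -/
def IsMaximalOrderIn (R F : Type*) {D : Type*} [CommRing R] [Field F] [Ring D] [Algebra R D]
    [Algebra F D] (Λ : Subalgebra R D) : Prop :=
  Maximal (IsOrderIn R F) Λ

/-- The canonical map `R(a, b) → (a, b)`, coefficientwise `R → F`, from the `R`-algebra
`R(a, b) = ℍ[R,a,b]` with generators `i, j` and relations `i² = a`, `j² = b`, `ij = -ji`, to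
the quaternion algebra `(a, b)` over `F`. -/
def quatMap (R F : Type*) [CommRing R] [Field F] [Algebra R F] (a b : R) :
    ℍ[R,a,b] →ₐ[R] ℍ[F,algebraMap R F a,algebraMap R F b] where
  toFun x := ⟨algebraMap R F x.re, algebraMap R F x.imI, algebraMap R F x.imJ,
    algebraMap R F x.imK⟩
  map_one' := by ext <;> simp
  map_zero' := by ext <;> simp
  map_add' x y := by ext <;> simp
  map_mul' x y := by ext <;> simp
  commutes' r := by
    rw [IsScalarTower.algebraMap_apply R F ℍ[F,algebraMap R F a,algebraMap R F b]]
    ext <;> simp [QuaternionAlgebra.algebraMap_eq]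

/-- For `R`-algebra maps `f : A → A'` and `g : B → B'` into `F`-algebras, the canonical map
`A ⊗_R B → A' ⊗_F B'`, `a ⊗ b ↦ f a ⊗ g b`. -/
noncomputable def tensorMap {R F A B A' B' : Type*} [CommRing R] [Field F] [Algebra R F]
    [Ring A] [Algebra R A] [Ring B] [Algebra R B]
    [Ring A'] [Algebra R A'] [Algebra F A'] [IsScalarTower R F A']
    [Ring B'] [Algebra R B'] [Algebra F B'] [IsScalarTower R F B']
    (f : A →ₐ[R] A') (g : B →ₐ[R] B') : A ⊗[R] B →ₐ[R] A' ⊗[F] B' :=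
  Algebra.TensorProduct.lift
    (((Algebra.TensorProduct.includeLeft : A' →ₐ[F] A' ⊗[F] B').restrictScalars R).comp f)
    (((Algebra.TensorProduct.includeRight : B' →ₐ[F] A' ⊗[F] B').restrictScalars R).comp g)
    (fun _ _ => (Commute.one_right _).tmul (Commute.one_left _))

theorem tensorMap_tmul {R F A B A' B' : Type*} [CommRing R] [Field F] [Algebra R F]
    [Ring A] [Algebra R A] [Ring B] [Algebra R B]
    [Ring A'] [Algebra R A'] [Algebra F A'] [IsScalarTower R F A']
    [Ring B'] [Algebra R B'] [Algebra F B'] [IsScalarTower R F B']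
    (f : A →ₐ[R] A') (g : B →ₐ[R] B') (a : A) (b : B) :
    tensorMap (F := F) f g (a ⊗ₜ[R] b) = f a ⊗ₜ[F] g b := by
  refine (Algebra.TensorProduct.lift_tmul _ _ _ a b).trans ?_
  change (f a ⊗ₜ[F] (1 : B')) * ((1 : A') ⊗ₜ[F] g b) = _
  rw [Algebra.TensorProduct.tmul_mul_tmul, mul_one, one_mul]

/-- With `D₀ = F ⊗_R Γ₀`, and `Γ₁` mapped to the `F`-algebra `D₁` by `g`: if `D₀ ⊗_F D₁` is a
division algebra then `Γ₀ ⊗_R Γ₁` is a maximal `R`-order in it, that is, the canonical map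
`Γ₀ ⊗_R Γ₁ → D₀ ⊗_F D₁` is injective and its image is a maximal `R`-order. -/
def TensorIsMaximalOrder (R F Γ₀ : Type*) {Γ₁ D₁ : Type*} [CommRing R] [Field F] [Algebra R F]
    [Ring Γ₀] [Algebra R Γ₀] [Ring Γ₁] [Algebra R Γ₁]
    [Ring D₁] [Algebra R D₁] [Algebra F D₁] [IsScalarTower R F D₁]
    (g : Γ₁ →ₐ[R] D₁) : Prop :=
  let ι : Γ₀ ⊗[R] Γ₁ →ₐ[R] (F ⊗[R] Γ₀) ⊗[F] D₁ :=
    tensorMap (Algebra.TensorProduct.includeRight : Γ₀ →ₐ[R] F ⊗[R] Γ₀) g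
  IsDivision ((F ⊗[R] Γ₀) ⊗[F] D₁) →
    Function.Injective ι ∧ IsMaximalOrderIn R F ι.range

end MaxOrd

namespace MaxOrd

open IsLocalRing

/-! Because `Γ₀` is Azumaya, `Γ₀ ⊗ Γ₀ᵐᵒᵖ` is the full endomorphism ring of `Γ₀`, so an overring `Λ`
of `Γ₀ ⊗ Γ₁` is closed under taking coordinates along a basis of `Γ₀`. Hence it is enough to treat
`Λ ∩ D₁`, a ring of integral elements containing `Γ₁` (`tensorIsMaximalOrder_of_forall_le_range`).
Of the division hypothesis, only nontriviality and the absence of zero divisors in `D₁` are used.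

`R` is a UFD, hence integrally closed, and 2 is a unit. For a quaternion in `Λ`, the traces of its
products with `1, i, j, k` lie in `R`, which bounds the denominators of its coordinates by `a`, `b`
and `ab`; integrality of the norm then gives a divisibility between the numerators
(`le_range_quatMap`). The denominators cancel when suitable forms `X² - wY²` are anisotropic modulo
`π` and `δ`. For a unit `w` this holds because `w` is not a square in `F`, as otherwise `D₁` would
have zero divisors: by Hensel `w` is then not a square modulo the maximal ideal, and descent in the
discrete valuation rings `R/π` and `R/δ` does the rest. For `w = δ` modulo `π`, and conversely, it
is parity of valuations.

In the biquaternion case, conjugation by `i` and `i'` splits `Λ` into its parts in `L`, `Lj`, `Lj'`,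
`Ljj'`, where `L = F[i, i']`. Traces handle `L`; each other part `LJ` lies in a quaternion algebra
over a quadratic subalgebra `F[C]` of `L`, where squaring an element plays the role of the norm
(`exists_coord_of_mul_mem`, `AnisotropicMod.biquadratic`). -/

/-- The binary form `X² - wY²` is anisotropic modulo the ideal `I`. -/
def AnisotropicMod {A : Type*} [CommRing A] (I : Ideal A) (w : A) : Prop :=
  ∀ b c : A, b ^ 2 - w * c ^ 2 ∈ I → b ∈ I ∧ c ∈ I

/-! ### Nonsquare units in a Henselian local ring -/

section Hensel

variable {R : Type*} [CommRing R] [IsLocalRing R]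

theorem isUnit_two_of_ringChar_residueField_ne_two (h : ringChar (ResidueField R) ≠ 2) :
    IsUnit (2 : R) := by
  rw [← residue_ne_zero_iff_isUnit, map_ofNat]
  exact Ring.two_ne_zero h

/-- A zero with `c` a unit makes `b/c` a root of `X² - u` in the residue field. It is simple because
2 and `u` are units, so it lifts to a square root of `u`. -/
theorem anisotropicMod_maximalIdeal {R : Type*} [CommRing R] [HenselianLocalRing R] (h2 : IsUnit (2 : R)) {u : R}
    (hu : IsUnit u) (hsq : ¬ IsSquare u) : AnisotropicMod (maximalIdeal R) u := by
  intro b c h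
  have hb : c ∈ maximalIdeal R → b ∈ maximalIdeal R := fun hc ↦ by
    refine (maximalIdeal.isMaximal R).isPrime.mem_of_pow_mem 2 ?_
    have := Ideal.add_mem _ h (Ideal.mul_mem_left _ u (Ideal.pow_mem_of_mem _ hc 2 two_pos))
    simpa using this
  by_cases hc : c ∈ maximalIdeal R
  · exact ⟨hb hc, hc⟩
  exfalso
  obtain ⟨c, rfl⟩ : IsUnit c := by simpa using hc
  set w : R := b * ↑c⁻¹
  have hw : w ^ 2 - u ∈ maximalIdeal R := by
    have := Ideal.mul_mem_right ((↑c⁻¹ : R) ^ 2) _ h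
    have hcc : (c : R) * ↑c⁻¹ = 1 := c.mul_inv
    convert this using 1
    simp only [w]
    linear_combination u * (c * ↑c⁻¹ + 1) * hcc
  have hwu : IsUnit w := by
    by_contra hn
    have hwm : w ∈ maximalIdeal R := hn
    have := Ideal.sub_mem _ (Ideal.pow_mem_of_mem _ hwm 2 two_pos) hw
    rw [sub_sub_cancel] at this
    exact this hu
  obtain ⟨a, ha, -⟩ := HenselianLocalRing.is_henselian (Polynomial.X ^ 2 - Polynomial.C u)
    (Polynomial.monic_X_pow_sub_C u two_ne_zero) w (by simpa using hw)
    (by simpa [one_add_one_eq_two] using h2.mul hwu)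
  refine hsq ⟨a, ?_⟩
  have : a ^ 2 - u = 0 := by simpa [Polynomial.IsRoot] using ha
  linear_combination -this

end Hensel

/-! ### Infinite descent for binary forms -/

section Descent

variable {Q : Type*} [CommRing Q] [IsDomain Q] [IsNoetherianRing Q] {δ : Q}

theorem eq_zero_of_forall_pow_dvd (hδ : Prime δ) {b : Q} (h : ∀ n : ℕ, δ ^ n ∣ b) : b = 0 := by
  by_contra hb
  obtain ⟨n, hn⟩ := FiniteMultiplicity.of_not_isUnit hδ.not_isUnit hb
  exact hn (h _)

/-- Both entries of a zero are divisible by `δ`, and dividing by `δ` yields another zero; in a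
Noetherian domain only 0 is divisible by every power of `δ`. -/
theorem AnisotropicMod.bot_of_span_prime (hδ : Prime δ) {w : Q}
    (hw : AnisotropicMod (Ideal.span {δ}) w) : AnisotropicMod (⊥ : Ideal Q) w := by
  have key : ∀ (n : ℕ) (b c : Q), b ^ 2 - w * c ^ 2 = 0 → δ ^ n ∣ b ∧ δ ^ n ∣ c := by
    intro n
    induction n with
    | zero => simp
    | succ n ih =>
      intro b c h
      obtain ⟨hb, hc⟩ := hw b c (by rw [h]; exact zero_mem _)
      obtain ⟨b, rfl⟩ := Ideal.mem_span_singleton.1 hb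
      obtain ⟨c, rfl⟩ := Ideal.mem_span_singleton.1 hc
      have h' : δ ^ 2 * (b ^ 2 - w * c ^ 2) = 0 := by linear_combination h
      have := ih b c ((mul_eq_zero.1 h').resolve_left (pow_ne_zero 2 hδ.ne_zero))
      rw [pow_succ']
      exact ⟨mul_dvd_mul_left _ this.1, mul_dvd_mul_left _ this.2⟩
  intro b c h
  exact ⟨eq_zero_of_forall_pow_dvd hδ fun n ↦ (key n b c h).1,
    eq_zero_of_forall_pow_dvd hδ fun n ↦ (key n b c h).2⟩

theorem anisotropicMod_bot_of_prime (hδ : Prime δ) : AnisotropicMod (⊥ : Ideal Q) δ := by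
  have key : ∀ (n : ℕ) (b c : Q), b ^ 2 - δ * c ^ 2 = 0 → δ ^ n ∣ b ∧ δ ^ n ∣ c := by
    intro n
    induction n with
    | zero => simp
    | succ n ih =>
      intro b c h
      obtain ⟨b, rfl⟩ : δ ∣ b := hδ.dvd_of_dvd_pow (n := 2) ⟨c ^ 2, by linear_combination h⟩
      have h' : δ * (δ * b ^ 2 - c ^ 2) = 0 := by linear_combination h
      replace h' := (mul_eq_zero.1 h').resolve_left hδ.ne_zero
      obtain ⟨c, rfl⟩ : δ ∣ c := hδ.dvd_of_dvd_pow (n := 2) ⟨b ^ 2, by linear_combination -h'⟩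
      have h'' : δ * (b ^ 2 - δ * c ^ 2) = 0 := by linear_combination h'
      have := ih b c ((mul_eq_zero.1 h'').resolve_left hδ.ne_zero)
      rw [pow_succ']
      exact ⟨mul_dvd_mul_left _ this.1, mul_dvd_mul_left _ this.2⟩
  intro b c h
  exact ⟨eq_zero_of_forall_pow_dvd hδ fun n ↦ (key n b c h).1,
    eq_zero_of_forall_pow_dvd hδ fun n ↦ (key n b c h).2⟩

theorem anisotropicMod_iff_quotient {A : Type*} [CommRing A] {I : Ideal A} {w : A} :
    AnisotropicMod I w ↔ AnisotropicMod (⊥ : Ideal (A ⧸ I)) (Ideal.Quotient.mk I w) := by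
  simp only [AnisotropicMod, Ideal.mem_bot, (Ideal.Quotient.mk_surjective (I := I)).forall,
    ← map_pow, ← map_mul, ← map_sub, Ideal.Quotient.eq_zero_iff_mem]

end Descent

/-! ### Two-dimensional regular local rings -/

section RegularTwo

variable {R : Type*} [CommRing R] [IsLocalRing R] [IsNoetherianRing R] {π δ : R}

/-- Otherwise the maximal ideal is minimal over `(π)`, and Krull's principal ideal theorem bounds
its height by 1. -/
theorem pow_not_mem_span_of_dim_two (hdim : ringKrullDim R = 2)
    (hm : maximalIdeal R = Ideal.span {π, δ}) (n : ℕ) : δ ^ n ∉ Ideal.span {π} := by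
  intro h
  have hmin : maximalIdeal R ∈ (Ideal.span {π}).minimalPrimes := by
    refine ⟨⟨inferInstance, hm ▸ Ideal.span_mono (by simp)⟩, fun q ⟨hq, hqπ⟩ _ ↦ ?_⟩
    rw [hm, Ideal.span_le, Set.insert_subset_iff, Set.singleton_subset_iff]
    exact ⟨hqπ (Ideal.mem_span_singleton_self π), hq.mem_of_pow_mem n (hqπ h)⟩
  have h1 := Ideal.height_le_one_of_isPrincipal_of_mem_minimalPrimes _ _ hmin
  have h2 := maximalIdeal_height_eq_ringKrullDim (R := R)
  rw [hdim] at h2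
  have h3 : (maximalIdeal R).height = 2 := WithBot.coe_inj.1 h2
  rw [h3] at h1
  exact absurd h1 (by decide)

theorem maximalIdeal_quotient_span {R : Type*} [CommRing R] [IsLocalRing R] {π δ : R}
    (hm : maximalIdeal R = Ideal.span {π, δ})
    [IsLocalRing (R ⧸ Ideal.span {π})] :
    maximalIdeal (R ⧸ Ideal.span {π}) = Ideal.span {Ideal.Quotient.mk _ δ} := by
  have hs : Function.Surjective (Ideal.Quotient.mk (Ideal.span {π})) :=
    Ideal.Quotient.mk_surjective
  rw [← map_maximalIdeal_of_surjective _ hs, hm, Ideal.map_span]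
  simp [Set.image_pair, Ideal.Quotient.eq_zero_iff_mem.2 (Ideal.mem_span_singleton_self π)]

theorem span_singleton_ne_top_of_maximalIdeal_eq {R : Type*} [CommRing R] [IsLocalRing R] {π δ : R}
    (hm : maximalIdeal R = Ideal.span {π, δ}) :
    Ideal.span {π} ≠ ⊤ :=
  ne_top_of_le_ne_top (maximalIdeal.isMaximal R).ne_top
    (hm ▸ Ideal.span_mono (by simp) : Ideal.span {π} ≤ maximalIdeal R)

/-- The maximal ideal of the quotient is generated by the image `d` of `δ`. By Krull's intersection
theorem each nonzero element is a unit times a power of `d`, and `d` is not nilpotent. -/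
theorem isDomain_quotient_span (hdim : ringKrullDim R = 2)
    (hm : maximalIdeal R = Ideal.span {π, δ}) : IsDomain (R ⧸ Ideal.span {π}) := by
  have : Nontrivial (R ⧸ Ideal.span {π}) :=
    Ideal.Quotient.nontrivial_iff.2 (span_singleton_ne_top_of_maximalIdeal_eq hm)
  have : IsLocalRing (R ⧸ Ideal.span {π}) :=
    .of_surjective' (Ideal.Quotient.mk _) Ideal.Quotient.mk_surjective
  set d := Ideal.Quotient.mk (Ideal.span {π}) δ
  have hd : ∀ n, d ^ n ≠ 0 := fun n h ↦ pow_not_mem_span_of_dim_two hdim hm n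
    (by rwa [← map_pow, Ideal.Quotient.eq_zero_iff_mem] at h)
  have hmax : maximalIdeal (R ⧸ Ideal.span {π}) = Ideal.span {d} := maximalIdeal_quotient_span hm
  have key : ∀ a : R ⧸ Ideal.span {π}, a ≠ 0 → ∃ (n : ℕ) (e : (R ⧸ Ideal.span {π})ˣ),
      a = d ^ n * e := by
    intro a ha
    by_contra! H
    have hall : ∀ n : ℕ, a ∈ maximalIdeal (R ⧸ Ideal.span {π}) ^ n := by
      intro n
      induction n with
      | zero => simp
      | succ n ih =>
        rw [hmax, Ideal.span_singleton_pow, Ideal.mem_span_singleton] at ih ⊢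
        obtain ⟨c, rfl⟩ := ih
        have hc : c ∈ maximalIdeal (R ⧸ Ideal.span {π}) := by
          rw [mem_maximalIdeal, mem_nonunits_iff]
          exact fun h ↦ H n h.unit rfl
        rw [hmax, Ideal.mem_span_singleton] at hc
        rw [pow_succ]
        exact mul_dvd_mul_left _ hc
    have hbot := Ideal.iInf_pow_eq_bot_of_isLocalRing _
      (maximalIdeal.isMaximal (R ⧸ Ideal.span {π})).ne_top
    exact ha (by simpa [hbot] using (Ideal.mem_iInf.2 hall))
  have : NoZeroDivisors (R ⧸ Ideal.span {π}) := ⟨fun {a b} hab ↦ by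
    by_contra! H
    obtain ⟨n, e, rfl⟩ := key a H.1
    obtain ⟨k, f, rfl⟩ := key b H.2
    refine hd (n + k) ?_
    rw [← (e * f).isUnit.mul_left_eq_zero, ← hab, Units.val_mul]
    ring⟩
  exact NoZeroDivisors.to_isDomain _

theorem prime_of_dim_two (hdim : ringKrullDim R = 2) (hm : maximalIdeal R = Ideal.span {π, δ}) :
    Prime π := by
  have := isDomain_quotient_span hdim hm
  refine (Ideal.span_singleton_prime ?_).1 ((Ideal.Quotient.isDomain_iff_prime _).1 this)
  rintro rfl
  exact pow_not_mem_span_of_dim_two (π := δ) (δ := 0) hdim (by rw [hm, Set.pair_comm]) 1 (by simp)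

theorem prime_mk_of_dim_two (hdim : ringKrullDim R = 2)
    (hm : maximalIdeal R = Ideal.span {π, δ}) :
    Prime (Ideal.Quotient.mk (Ideal.span {π}) δ) := by
  have := isDomain_quotient_span hdim hm
  have : IsLocalRing (R ⧸ Ideal.span {π}) :=
    .of_surjective' (Ideal.Quotient.mk _) Ideal.Quotient.mk_surjective
  refine (Ideal.span_singleton_prime ?_).1 ?_
  · rw [Ne, Ideal.Quotient.eq_zero_iff_mem]
    simpa using pow_not_mem_span_of_dim_two hdim hm 1
  · rw [← maximalIdeal_quotient_span hm]
    infer_instance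

theorem isPrincipalIdealRing_quotient_span (hdim : ringKrullDim R = 2)
    (hm : maximalIdeal R = Ideal.span {π, δ}) : IsPrincipalIdealRing (R ⧸ Ideal.span {π}) := by
  have := isDomain_quotient_span hdim hm
  have : IsLocalRing (R ⧸ Ideal.span {π}) :=
    .of_surjective' (Ideal.Quotient.mk _) Ideal.Quotient.mk_surjective
  have hmax := maximalIdeal_quotient_span hm
  have hp : (maximalIdeal (R ⧸ Ideal.span {π})).IsPrincipal := ⟨⟨_, hmax⟩⟩
  exact ((tfae_of_isNoetherianRing_of_isLocalRing_of_isDomain (R ⧸ Ideal.span {π})).out 0 4).2 hp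

/-- Kaplansky's criterion: each nonzero prime `p` must contain a prime element. If `π ∉ p`, the
image of `p` in the principal ideal ring `R/π` is generated by some `g ∈ p`; primality gives `p ⊆
(g) + πp`, and Nakayama gives `p = (g)`. -/
theorem uniqueFactorizationMonoid_of_dim_two [IsDomain R] (hdim : ringKrullDim R = 2)
    (hm : maximalIdeal R = Ideal.span {π, δ}) : UniqueFactorizationMonoid R := by
  rw [UniqueFactorizationMonoid.iff_exists_prime_mem_of_isPrime]
  intro p hp0 hp
  have hπ := prime_of_dim_two hdim hm
  by_cases hπp : π ∈ p
  · exact ⟨π, hπp, hπ⟩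
  have := isPrincipalIdealRing_quotient_span hdim hm
  obtain ⟨g', hg'⟩ := IsPrincipalIdealRing.principal (p.map (Ideal.Quotient.mk (Ideal.span {π})))
  have hg'mem : g' ∈ p.map (Ideal.Quotient.mk (Ideal.span {π})) :=
    hg' ▸ Ideal.mem_span_singleton_self g'
  obtain ⟨g, hg, rfl⟩ :=
    (Ideal.mem_map_iff_of_surjective _ Ideal.Quotient.mk_surjective).1 hg'mem
  have hle : p ≤ Ideal.span {g} ⊔ Ideal.span {π} • p := by
    intro x hx
    have hxm := Ideal.mem_map_of_mem (Ideal.Quotient.mk (Ideal.span {π})) hx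
    rw [hg'] at hxm
    obtain ⟨c', hc'⟩ := Ideal.mem_span_singleton.1 hxm
    obtain ⟨c, rfl⟩ := Ideal.Quotient.mk_surjective c'
    rw [← map_mul, Ideal.Quotient.eq, Ideal.mem_span_singleton] at hc'
    obtain ⟨d, hd⟩ := hc'
    have hdp : d ∈ p := (hp.mem_or_mem (hd ▸ p.sub_mem hx (p.mul_mem_right c hg))).resolve_left hπp
    rw [sub_eq_iff_eq_add'.1 hd]
    exact Submodule.add_mem_sup (Ideal.mul_mem_right _ _ (Ideal.mem_span_singleton_self g))
      (Submodule.smul_mem_smul (Ideal.mem_span_singleton_self π) hdp)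
  have hπm : Ideal.span {π} ≤ maximalIdeal R := hm ▸ Ideal.span_mono (by simp)
  have hpg : p = Ideal.span {g} := le_antisymm
    (Submodule.le_of_le_smul_of_le_jacobson_bot (IsNoetherian.noetherian p)
      (hπm.trans (maximalIdeal_le_jacobson _)) hle) ((Ideal.span_singleton_le_iff_mem p).2 hg)
  subst hpg
  exact ⟨g, hg, (Ideal.span_singleton_prime (by rintro rfl; simp at hp0)).1 hp⟩

theorem AnisotropicMod.span_of_maximalIdeal (hdim : ringKrullDim R = 2)
    (hm : maximalIdeal R = Ideal.span {π, δ}) {w : R}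
    (hw : AnisotropicMod (maximalIdeal R) w) : AnisotropicMod (Ideal.span {π}) w := by
  have := isDomain_quotient_span hdim hm
  rw [anisotropicMod_iff_quotient]
  refine AnisotropicMod.bot_of_span_prime (prime_mk_of_dim_two hdim hm) ?_
  have hcomap : ∀ x : R, Ideal.Quotient.mk (Ideal.span {π}) x ∈
      Ideal.span {Ideal.Quotient.mk (Ideal.span {π}) δ} ↔ x ∈ maximalIdeal R := by
    intro x
    have : Ideal.span {Ideal.Quotient.mk (Ideal.span {π}) δ} =
        (maximalIdeal R).map (Ideal.Quotient.mk (Ideal.span {π})) := by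
      rw [hm, Ideal.map_span]
      simp [Set.image_pair, Ideal.Quotient.eq_zero_iff_mem.2 (Ideal.mem_span_singleton_self π)]
    rw [this, Ideal.mem_quotient_iff_mem (hm ▸ Ideal.span_mono (by simp))]
  simp only [AnisotropicMod, (Ideal.Quotient.mk_surjective (I := Ideal.span {π})).forall,
    ← map_pow, ← map_mul, ← map_sub, hcomap]
  exact hw

theorem anisotropicMod_span_of_dim_two (hdim : ringKrullDim R = 2)
    (hm : maximalIdeal R = Ideal.span {π, δ}) : AnisotropicMod (Ideal.span {π}) δ := by
  have := isDomain_quotient_span hdim hm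
  exact anisotropicMod_iff_quotient.2 (anisotropicMod_bot_of_prime (prime_mk_of_dim_two hdim hm))

end RegularTwo

/-! ### Anisotropy after adjoining a square root -/

section Biquadratic

/-- If `w`, `z` and `wz` are anisotropic modulo a prime `p`, then `w` is anisotropic modulo `p`
after adjoining a square root of `z`; here `pᵢ`, `qᵢ` are the coordinates. -/
theorem AnisotropicMod.biquadratic {A : Type*} [CommRing A] {I : Ideal A} [I.IsPrime]
    (h2 : IsUnit (2 : A)) {w z : A} (hw : AnisotropicMod I w) (hz : AnisotropicMod I z)
    (hwz : AnisotropicMod I (w * z)) {p₀ p₁ q₀ q₁ : A}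
    (h₁ : p₀ ^ 2 + z * p₁ ^ 2 - w * (q₀ ^ 2 + z * q₁ ^ 2) ∈ I)
    (h₂ : 2 * (p₀ * p₁ - w * q₀ * q₁) ∈ I) : p₀ ∈ I ∧ p₁ ∈ I ∧ q₀ ∈ I ∧ q₁ ∈ I := by
  have hpr : I.IsPrime := inferInstance
  have hz0 : z ∉ I := fun h ↦ hpr.ne_top ((Ideal.eq_top_iff_one I).2
    (hz 0 1 (by simpa using h)).2)
  replace h₂ : p₀ * p₁ - w * q₀ * q₁ ∈ I := (hpr.mem_or_mem h₂).resolve_left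
    fun h ↦ hpr.ne_top (Ideal.eq_top_of_isUnit_mem _ h h2)
  -- the coordinates of `(p₀ + p₁√z)(q₀ - q₁√z)` and the norm of `q₀ + q₁√z`
  set e := p₀ * q₀ - z * p₁ * q₁ with he
  set f := p₁ * q₀ - p₀ * q₁ with hf
  set n := q₀ ^ 2 - z * q₁ ^ 2 with hn
  have hef : e * f ∈ I := by
    have := I.sub_mem (I.mul_mem_left (q₀ ^ 2 + z * q₁ ^ 2) h₂)
      (I.mul_mem_left (q₀ * q₁) h₁)
    convert this using 1
    rw [he, hf]; ring
  have hsq : e ^ 2 + z * f ^ 2 - w * n ^ 2 ∈ I := by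
    have := I.sub_mem (I.mul_mem_left (q₀ ^ 2 + z * q₁ ^ 2) h₁)
      (I.mul_mem_left (4 * z * q₀ * q₁) h₂)
    convert this using 1
    rw [he, hf, hn]; ring
  have hnI : n ∈ I := by
    -- Modulo `I`, `(e + f√z)² = wn²`. If `e = 0` then `(zf)² = wzn²`, if `f = 0` then `e² = wn²`;
    -- either way the norm `n` vanishes.
    rcases hpr.mem_or_mem hef with h | h
    · have h3 : (z * f) ^ 2 - w * z * n ^ 2 ∈ I := by
        have := I.sub_mem (I.mul_mem_left z hsq) (I.mul_mem_left (z * e) h)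
        convert this using 1
        ring
      exact (hwz _ _ h3).2
    · have h3 : e ^ 2 - w * n ^ 2 ∈ I := by
        have := I.sub_mem hsq (I.mul_mem_left (z * f) h)
        convert this using 1
        ring
      exact (hw _ _ h3).2
  obtain ⟨hq₀, hq₁⟩ := hz _ _ hnI
  have hpp : p₀ * p₁ ∈ I := by
    have := I.add_mem h₂ (I.mul_mem_left (w * q₀) hq₁)
    convert this using 1
    ring
  have hps : p₀ ^ 2 + z * p₁ ^ 2 ∈ I := by
    have := I.add_mem h₁ (I.add_mem (I.mul_mem_left (w * q₀) hq₀) (I.mul_mem_left (w * z * q₁) hq₁))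
    convert this using 1
    ring
  rcases hpr.mem_or_mem hpp with h | h
  · have h3 : z * p₁ ^ 2 ∈ I := by
      have := I.sub_mem hps (I.mul_mem_left p₀ h)
      convert this using 1
      ring
    exact ⟨h, hpr.mem_of_pow_mem 2 ((hpr.mem_or_mem h3).resolve_left hz0), hq₀, hq₁⟩
  · have h3 : p₀ ^ 2 ∈ I := by
      have := I.sub_mem hps (I.mul_mem_left (z * p₁) h)
      convert this using 1
      ring
    exact ⟨hpr.mem_of_pow_mem 2 h3, h, hq₀, hq₁⟩

end Biquadratic

/-! ### Removing the Azumaya factor -/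

section Reduction

variable {R F A D : Type*} [CommRing R] [Field F] [Algebra R F] [Ring A] [Algebra R A]
  [Ring D] [Algebra F D]

/-- The action of `A ⊗ Aᵐᵒᵖ` on `A` extends to `(F ⊗ A) ⊗ D` and preserves each subalgebra which
contains `A`. -/
theorem exists_linearMap_of_mulLeftRight (Λ : Subalgebra R ((F ⊗[R] A) ⊗[F] D))
    (hΛ : ∀ a : A, ((1 : F) ⊗ₜ[R] a) ⊗ₜ[F] (1 : D) ∈ Λ) (t : A ⊗[R] Aᵐᵒᵖ) :
    ∃ Φ : (F ⊗[R] A) ⊗[F] D →ₗ[R] (F ⊗[R] A) ⊗[F] D, (∀ z ∈ Λ, Φ z ∈ Λ) ∧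
      ∀ (a : A) (y : D), Φ (((1 : F) ⊗ₜ[R] a) ⊗ₜ[F] y) =
        ((1 : F) ⊗ₜ[R] AlgHom.mulLeftRight R A t a) ⊗ₜ[F] y := by
  induction t with
  | zero => exact ⟨0, fun z _ ↦ by simp, fun a y ↦ by simp⟩
  | add s t hs ht =>
    obtain ⟨Φ, h, h'⟩ := hs
    obtain ⟨Ψ, k, k'⟩ := ht
    refine ⟨Φ + Ψ, fun z hz ↦ Λ.add_mem (h z hz) (k z hz), fun a y ↦ ?_⟩
    simp [h', k', TensorProduct.tmul_add, TensorProduct.add_tmul]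
  | tmul p q =>
    refine ⟨LinearMap.mulLeft R (((1 : F) ⊗ₜ[R] p) ⊗ₜ[F] (1 : D)) ∘ₗ
      LinearMap.mulRight R (((1 : F) ⊗ₜ[R] q.unop) ⊗ₜ[F] (1 : D)),
      fun z hz ↦ Λ.mul_mem (hΛ _) (Λ.mul_mem hz (hΛ _)), fun a y ↦ ?_⟩
    simp [Algebra.TensorProduct.tmul_mul_tmul, mul_assoc]

variable (F) in
theorem exists_sum_tmul {κ : Type*} [Fintype κ] (e : Module.Basis κ R A)
    (z : (F ⊗[R] A) ⊗[F] D) :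
    ∃ y : κ → D, z = ∑ k, ((1 : F) ⊗ₜ[R] e k) ⊗ₜ[F] y k := by
  induction z with
  | zero => exact ⟨0, by simp⟩
  | add z w hz hw =>
    obtain ⟨y, rfl⟩ := hz
    obtain ⟨y', rfl⟩ := hw
    exact ⟨y + y', by simp [TensorProduct.tmul_add, Finset.sum_add_distrib]⟩
  | tmul x d =>
    refine ⟨fun k ↦ (e.baseChange F).repr x k • d, ?_⟩
    conv_lhs => rw [← (e.baseChange F).sum_repr x, TensorProduct.sum_tmul]
    simp [TensorProduct.smul_tmul]

theorem includeRight_injective_of_nontrivial {B : Type*} [Ring B] [Algebra F B]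
    [Nontrivial (B ⊗[F] D)] :
    Function.Injective (Algebra.TensorProduct.includeRight : D →ₐ[F] B ⊗[F] D) := by
  have hB : Nontrivial B := by
    by_contra hB
    rw [not_nontrivial_iff_subsingleton] at hB
    exact not_subsingleton (B ⊗[F] D) inferInstance
  exact Algebra.TensorProduct.includeRight_injective (FaithfulSMul.algebraMap_injective F B)

theorem noZeroDivisors_of_isDivision_tensorProduct {B : Type*} [Ring B] [Algebra F B]
    (h : IsDivision (B ⊗[F] D)) : NoZeroDivisors D := by
  obtain ⟨hn, hu⟩ := h
  have hinj := includeRight_injective_of_nontrivial (F := F) (D := D) (B := B)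
  refine ⟨fun {a b} hab ↦ or_iff_not_imp_left.2 fun ha ↦ ?_⟩
  have h1 := hu (Algebra.TensorProduct.includeRight a) (by simpa using hinj.ne ha)
  have h2 : (Algebra.TensorProduct.includeRight a : B ⊗[F] D) *
      Algebra.TensorProduct.includeRight b = 0 := by
    rw [← map_mul, hab, map_zero]
  exact hinj ((h1.mul_right_eq_zero.1 h2).trans (map_zero _).symm)

end Reduction

/-- The Azumaya factor disappears: after expanding `z ∈ Λ` along a basis of `Γ₀`, each coefficient
already lies in `Λ ∩ D₁`, to which `H` applies. -/
theorem tensorIsMaximalOrder_of_forall_le_range {R F Γ₀ Γ₁ D₁ ι : Type*} [CommRing R]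
    [IsLocalRing R] [IsNoetherianRing R] [Field F] [Algebra R F] [IsFractionRing R F]
    [Ring Γ₀] [Algebra R Γ₀] [IsAzumaya R Γ₀] [Ring Γ₁] [Algebra R Γ₁]
    [Ring D₁] [Algebra R D₁] [Algebra F D₁] [IsScalarTower R F D₁] [Fintype ι]
    (b : Module.Basis ι R Γ₁) (b' : Module.Basis ι F D₁) (g : Γ₁ →ₐ[R] D₁)
    (hg : ∀ i, g (b i) = b' i)
    (H : NoZeroDivisors D₁ → ∀ Λ : Subalgebra R D₁, g.range ≤ Λ →
      (∀ x ∈ Λ, IsIntegral R x) → Λ ≤ g.range) :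
    TensorIsMaximalOrder R F Γ₀ g := by
  intro hdiv
  set ι₀ : Γ₀ ⊗[R] Γ₁ →ₐ[R] (F ⊗[R] Γ₀) ⊗[F] D₁ :=
    tensorMap (Algebra.TensorProduct.includeRight : Γ₀ →ₐ[R] F ⊗[R] Γ₀) g
  have : Module.Free R Γ₀ := Module.free_of_flat_of_isLocalRing
  let e := Module.Free.chooseBasis R Γ₀
  let B := e.tensorProduct b
  let B' := (e.baseChange F).tensorProduct b'
  have hB : ∀ i, ι₀ (B i) = B' i := by
    rintro ⟨k, l⟩
    simp [B, B', ι₀, tensorMap_tmul, hg, Module.Basis.tensorProduct_apply]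
  have hcoord : ∀ (z : Γ₀ ⊗[R] Γ₁) i, B'.repr (ι₀ z) i = algebraMap R F (B.repr z i) := by
    intro z i
    have : ι₀ z = ∑ j, algebraMap R F (B.repr z j) • B' j := by
      conv_lhs => rw [← B.sum_repr z, map_sum]
      simp [hB]
    rw [this, B'.repr_sum_self]
  have hinj : Function.Injective ι₀ := by
    intro x y hxy
    refine B.ext_elem fun i ↦ IsFractionRing.injective R F ?_
    rw [← hcoord, ← hcoord, hxy]
  have hfin : Module.Finite R Γ₁ := .of_basis b
  refine ⟨hinj, ⟨⟨?_, ?_⟩, ?_⟩⟩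
  · have : (Subalgebra.toSubmodule ι₀.range) = LinearMap.range ι₀.toLinearMap := rfl
    rw [this, LinearMap.range_eq_map]
    exact Module.Finite.fg_top.map _
  · rw [eq_top_iff, ← B'.span_eq]
    refine Submodule.span_mono ?_
    rintro _ ⟨i, rfl⟩
    exact ⟨B i, hB i⟩
  · intro Λ hΛ hle z hz
    have hint : ∀ x ∈ Λ, IsIntegral R x := fun x hx ↦ IsIntegral.of_mem_of_fg Λ hΛ.finite x hx
    obtain ⟨y, rfl⟩ := exists_sum_tmul F e z
    have hF : Function.Injective (Algebra.TensorProduct.includeRight :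
        D₁ →ₐ[F] (F ⊗[R] Γ₀) ⊗[F] D₁) :=
      have := hdiv.1
      includeRight_injective_of_nontrivial
    let j : D₁ →ₐ[R] (F ⊗[R] Γ₀) ⊗[F] D₁ :=
      (Algebra.TensorProduct.includeRight : D₁ →ₐ[F] (F ⊗[R] Γ₀) ⊗[F] D₁).restrictScalars R
    have hj : ∀ d, j d = ((1 : F) ⊗ₜ[R] (1 : Γ₀)) ⊗ₜ[F] d := fun _ ↦ rfl
    have hy : ∀ k, y k ∈ Λ.comap j := by
      intro k
      -- `t` acts on `Γ₀` as `x ↦ e_k*(x) · 1`, so its extension sends `z` to `1 ⊗ y k` without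
      -- leaving `Λ`.
      obtain ⟨t, ht⟩ := (IsAzumaya.bij (R := R) (A := Γ₀)).2
        ((e.coord k).smulRight (1 : Γ₀))
      obtain ⟨Φ, hΦ, hΦ'⟩ := exists_linearMap_of_mulLeftRight Λ
        (fun a ↦ hle ⟨a ⊗ₜ 1, by simp [ι₀, tensorMap_tmul]⟩) t
      have := hΦ _ hz
      simp only [map_sum, hΦ', ht] at this
      rw [Subalgebra.mem_comap, hj]
      classical
      convert this
      rw [Finset.sum_eq_single k]
      · simp
      · intro l _ hl
        simp [hl]
      · simp
    have hk : ∀ k, y k ∈ g.range := by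
      intro k
      refine H (noZeroDivisors_of_isDivision_tensorProduct hdiv) (Λ.comap j) ?_ ?_ (hy k)
      · rintro _ ⟨c, rfl⟩
        exact hle ⟨1 ⊗ₜ c, by simp [ι₀, tensorMap_tmul, hj]⟩
      · intro x hx
        exact (isIntegral_algHom_iff j (fun _ _ h ↦ hF h)).1 (hint _ hx)
    choose c hc using fun k ↦ (AlgHom.mem_range g).1 (hk k)
    refine ⟨∑ k, e k ⊗ₜ c k, ?_⟩
    simp [ι₀, tensorMap_tmul, hc]

/-! ### Integral elements of noncommutative algebras -/

section Integral

variable {R B : Type*} [CommRing R] [Ring B] [Algebra R B] {x y : B}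

-- Two commuting elements generate a commutative subalgebra, where the usual closure properties
-- hold.
open scoped IsMulCommutative in
theorem isIntegral_add_and_mul_of_commute (h : Commute x y) (hx : IsIntegral R x)
    (hy : IsIntegral R y) : IsIntegral R (x + y) ∧ IsIntegral R (x * y) := by
  let S := Algebra.adjoin R ({x, y} : Set B)
  have hc : ∀ a ∈ ({x, y} : Set B), ∀ b ∈ ({x, y} : Set B), a * b = b * a := by
    rintro a (rfl | rfl) b (rfl | rfl)
    exacts [rfl, h, h.symm, rfl]
  have : IsMulCommutative S := Algebra.isMulCommutative_adjoin R hc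
  let x' : S := ⟨x, Algebra.subset_adjoin (by simp)⟩
  let y' : S := ⟨y, Algebra.subset_adjoin (by simp)⟩
  have hinj : Function.Injective S.val := Subtype.val_injective
  have hx' : IsIntegral R x' := (isIntegral_algHom_iff S.val hinj).1 hx
  have hy' : IsIntegral R y' := (isIntegral_algHom_iff S.val hinj).1 hy
  exact ⟨(hx'.add hy').map S.val, (hx'.mul hy').map S.val⟩

theorem _root_.IsIntegral.add_of_commute (h : Commute x y) (hx : IsIntegral R x)
    (hy : IsIntegral R y) : IsIntegral R (x + y) :=
  (isIntegral_add_and_mul_of_commute h hx hy).1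

theorem _root_.IsIntegral.mul_of_commute (h : Commute x y) (hx : IsIntegral R x)
    (hy : IsIntegral R y) : IsIntegral R (x * y) :=
  (isIntegral_add_and_mul_of_commute h hx hy).2

theorem _root_.IsIntegral.conj {a b : B} (hba : b * a = 1) (hab : a * b = 1)
    (hx : IsIntegral R x) : IsIntegral R (a * x * b) :=
  hx.map (AlgHom.ofLinearMap (LinearMap.mulRight R b ∘ₗ LinearMap.mulLeft R a)
    (by simp [hab]) (fun p q ↦ by
      simp only [LinearMap.coe_comp, Function.comp_apply, LinearMap.mulLeft_apply,
        LinearMap.mulRight_apply]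
      rw [show a * p * b * (a * q * b) = a * p * (b * a) * q * b by simp only [mul_assoc], hba]
      simp only [mul_assoc, one_mul]))

theorem exists_algebraMap_eq_of_isIntegral {R F D : Type*} [CommRing R] [IsDomain R]
    [IsIntegrallyClosed R] [Field F] [Algebra R F] [IsFractionRing R F] [Ring D] [Nontrivial D]
    [Algebra R D] [Algebra F D] [IsScalarTower R F D] {c : F}
    (h : IsIntegral R (algebraMap F D c)) : ∃ r : R, algebraMap R F r = c :=
  IsIntegrallyClosed.isIntegral_iff.1 ((isIntegral_algebraMap_iff (algebraMap F D).injective).1 h)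

end Integral

section Scalars

variable {R F : Type*} [CommRing R] [Field F] [Algebra R F]

theorem exists_algebraMap_eq_of_two_mul (h2 : IsUnit (2 : R)) {c : F}
    (h : ∃ r : R, algebraMap R F r = 2 * c) : ∃ r : R, algebraMap R F r = c := by
  obtain ⟨r, hr⟩ := h
  obtain ⟨t, ht⟩ := h2.exists_left_inv
  refine ⟨t * r, ?_⟩
  have := congrArg (algebraMap R F) ht
  simp only [map_mul, map_one, map_ofNat] at this
  rw [map_mul, hr]
  linear_combination c * this

theorem exists_algebraMap_eq_of_unit_mul (u : Rˣ) {c : F}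
    (h : ∃ r : R, algebraMap R F r = algebraMap R F u * c) : ∃ r : R, algebraMap R F r = c := by
  obtain ⟨r, hr⟩ := h
  refine ⟨↑u⁻¹ * r, ?_⟩
  rw [map_mul, hr, ← mul_assoc, ← map_mul, Units.inv_mul, map_one, one_mul]

end Scalars

/-! ### Overrings of a quaternion order -/

section Quaternion

variable {R F : Type*} [CommRing R] [IsDomain R] [IsIntegrallyClosed R] [Field F] [Algebra R F]
  [IsFractionRing R F]

theorem exists_of_isIntegral_quaternion (h2 : IsUnit (2 : R)) {a b : F} {q : ℍ[F,a,b]}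
    (hq : IsIntegral R q) : (∃ r : R, algebraMap R F r = q.re) ∧
      ∃ r : R, algebraMap R F r =
        q.re ^ 2 - a * q.imI ^ 2 - b * q.imJ ^ 2 + a * b * q.imK ^ 2 := by
  -- Conjugation is an isomorphism onto the opposite algebra, and a polynomial in one element
  -- evaluates alike there; so `star q` satisfies the same monic equation as `q`.
  have hs : IsIntegral R (star q) := by
    have := hq.map ((QuaternionAlgebra.starAe : ℍ[F,a,b] ≃ₐ[F] _).restrictScalars R)
    obtain ⟨p, hp, hp'⟩ := this
    refine ⟨p, hp, ?_⟩
    rw [← Polynomial.aeval_def] at hp' ⊢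
    have h3 : (QuaternionAlgebra.starAe : ℍ[F,a,b] ≃ₐ[F] _).restrictScalars R q =
      MulOpposite.op (star q) := rfl
    rw [h3] at hp'
    rw [Polynomial.aeval_eq_sum_range] at hp' ⊢
    apply MulOpposite.op_injective
    simpa [Finset.op_sum] using hp'
  have hcomm : Commute q (star q) := by
    change q * star q = star q * q
    ext <;> simp <;> ring
  have h1 := hq.add_of_commute hcomm hs
  have h3 := hq.mul_of_commute hcomm hs
  have e1 : q + star q = algebraMap F ℍ[F,a,b] (2 * q.re) := by
    rw [QuaternionAlgebra.algebraMap_eq]; ext <;> simp; ring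
  have e3 : q * star q = algebraMap F ℍ[F,a,b]
      (q.re ^ 2 - a * q.imI ^ 2 - b * q.imJ ^ 2 + a * b * q.imK ^ 2) := by
    rw [QuaternionAlgebra.algebraMap_eq]; ext <;> simp <;> ring
  rw [e1] at h1
  rw [e3] at h3
  obtain ⟨r, hr⟩ := exists_algebraMap_eq_of_isIntegral h1
  exact ⟨exists_algebraMap_eq_of_two_mul h2 ⟨r, hr⟩, exists_algebraMap_eq_of_isIntegral h3⟩

/-- Let `x₁, x₂, x₃` be the imaginary coordinates of `q`. The real parts of `qi`, `qj`, `qk` are `r₁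
= ax₁`, `r₂ = bx₂`, `r₃ = -abx₃`, all in `R`, and `br₁² + ar₂² - r₃² = ab(r₀² - n)` with `n` the
norm. So `H` is exactly what clears the denominators. -/
theorem le_range_quatMap (h2 : IsUnit (2 : R)) {a b : R} (ha : a ≠ 0) (hb : b ≠ 0)
    (H : ∀ r₁ r₂ r₃ : R, a * b ∣ b * r₁ ^ 2 + a * r₂ ^ 2 - r₃ ^ 2 →
      a ∣ r₁ ∧ b ∣ r₂ ∧ a * b ∣ r₃)
    (Λ : Subalgebra R ℍ[F,algebraMap R F a,algebraMap R F b]) (hle : (quatMap R F a b).range ≤ Λ)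
    (hint : ∀ x ∈ Λ, IsIntegral R x) : Λ ≤ (quatMap R F a b).range := by
  intro q hq
  have hinj := IsFractionRing.injective R F
  have ha' : algebraMap R F a ≠ 0 := by simpa using ha
  have hb' : algebraMap R F b ≠ 0 := by simpa using hb
  have hmem : ∀ p, quatMap R F a b p ∈ Λ := fun p ↦ hle ⟨p, rfl⟩
  obtain ⟨⟨r₀, h₀⟩, n, hn⟩ := exists_of_isIntegral_quaternion h2 (hint _ hq)
  obtain ⟨⟨r₁, h₁⟩, -⟩ := exists_of_isIntegral_quaternion h2
    (hint _ (Λ.mul_mem hq (hmem ⟨0, 1, 0, 0⟩)))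
  obtain ⟨⟨r₂, h₂⟩, -⟩ := exists_of_isIntegral_quaternion h2
    (hint _ (Λ.mul_mem hq (hmem ⟨0, 0, 1, 0⟩)))
  obtain ⟨⟨r₃, h₃⟩, -⟩ := exists_of_isIntegral_quaternion h2
    (hint _ (Λ.mul_mem hq (hmem ⟨0, 0, 0, 1⟩)))
  simp [quatMap] at h₁ h₂ h₃
  obtain ⟨⟨s₁, rfl⟩, ⟨s₂, rfl⟩, s₃, rfl⟩ := H r₁ r₂ r₃ ⟨r₀ ^ 2 - n, by
    apply hinj
    simp only [map_sub, map_add, map_mul, map_pow, h₀, h₁, h₂, h₃, hn]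
    ring⟩
  simp only [map_mul] at h₁ h₂ h₃
  refine ⟨⟨r₀, s₁, s₂, -s₃⟩, ?_⟩
  ext
  · exact h₀
  · exact mul_left_cancel₀ ha' h₁
  · exact mul_left_cancel₀ hb' h₂
  · refine mul_left_cancel₀ (mul_ne_zero ha' hb') ?_
    change _ * algebraMap R F (-s₃) = _
    rw [map_neg]
    linear_combination -h₃

theorem not_isSquare_of_noZeroDivisors {a b : F} [NoZeroDivisors ℍ[F,a,b]] :
    ¬ IsSquare a := by
  rintro ⟨w, rfl⟩
  have : ((⟨w, 1, 0, 0⟩ : ℍ[F,w * w,b]) * ⟨-w, 1, 0, 0⟩) = 0 := by ext <;> simp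
  rcases mul_eq_zero.1 this with h | h
  · simpa using congrArg QuaternionAlgebra.imI h
  · simpa using congrArg QuaternionAlgebra.imI h

end Quaternion

/-! ### Divisibility conditions for the quaternion cases -/

section Arithmetic

variable {R : Type*} [CommRing R]

theorem AnisotropicMod.dvd_of_isUnit {u b : R} (hu : IsUnit u)
    (h : AnisotropicMod (Ideal.span {b}) u) (r₁ r₂ r₃ : R)
    (hd : u * b ∣ b * r₁ ^ 2 + u * r₂ ^ 2 - r₃ ^ 2) : u ∣ r₁ ∧ b ∣ r₂ ∧ u * b ∣ r₃ := by
  have h1 : b ∣ r₃ ^ 2 - u * r₂ ^ 2 := by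
    have := (Dvd.intro (r₁ ^ 2) rfl : b ∣ b * r₁ ^ 2).sub ((dvd_mul_left b u).trans hd)
    convert this using 1
    ring
  obtain ⟨h3, h2⟩ := h _ _ (Ideal.mem_span_singleton.2 h1)
  rw [Ideal.mem_span_singleton] at h2 h3
  exact ⟨hu.dvd, h2, hu.mul_left_dvd.2 h3⟩

theorem mul_dvd_of_prime [IsDomain R] {π δ : R} (hδ : Prime δ) (h : ¬ δ ∣ π) {x : R}
    (h₁ : π ∣ x) (h₂ : δ ∣ x) : π * δ ∣ x := by
  obtain ⟨y, rfl⟩ := h₁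
  exact mul_dvd_mul_left _ ((hδ.dvd_or_dvd h₂).resolve_left h)

theorem AnisotropicMod.mul [IsDomain R] {π δ w : R} (hδ : Prime δ) (h : ¬ δ ∣ π)
    (h₁ : AnisotropicMod (Ideal.span {π}) w) (h₂ : AnisotropicMod (Ideal.span {δ}) w) :
    AnisotropicMod (Ideal.span {π * δ}) w := by
  intro b c hbc
  simp only [AnisotropicMod, Ideal.mem_span_singleton] at *
  obtain ⟨hb, hc⟩ := h₁ b c ((dvd_mul_right _ _).trans hbc)
  obtain ⟨hb', hc'⟩ := h₂ b c ((dvd_mul_left _ _).trans hbc)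
  exact ⟨mul_dvd_of_prime hδ h hb hb', mul_dvd_of_prime hδ h hc hc'⟩

/-- Modulo `π` the form reduces to `δr₁² - r₃²`, modulo `δ` to `πr₂² - r₃²`. -/
theorem dvd_of_anisotropicMod_params [IsDomain R] {π δ : R} (hδ : Prime δ)
    (h : ¬ δ ∣ π) (h₁ : AnisotropicMod (Ideal.span {π}) δ)
    (h₂ : AnisotropicMod (Ideal.span {δ}) π) (r₁ r₂ r₃ : R)
    (hd : π * δ ∣ δ * r₁ ^ 2 + π * r₂ ^ 2 - r₃ ^ 2) : π ∣ r₁ ∧ δ ∣ r₂ ∧ π * δ ∣ r₃ := by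
  simp only [AnisotropicMod, Ideal.mem_span_singleton] at *
  have e₁ : π ∣ r₃ ^ 2 - δ * r₁ ^ 2 := by
    have := (Dvd.intro (r₂ ^ 2) rfl : π ∣ π * r₂ ^ 2).sub ((dvd_mul_right π δ).trans hd)
    convert this using 1
    ring
  have e₂ : δ ∣ r₃ ^ 2 - π * r₂ ^ 2 := by
    have := (Dvd.intro (r₁ ^ 2) rfl : δ ∣ δ * r₁ ^ 2).sub ((dvd_mul_left δ π).trans hd)
    convert this using 1
    ring
  exact ⟨(h₁ _ _ e₁).2, (h₂ _ _ e₂).2, mul_dvd_of_prime hδ h (h₁ _ _ e₁).1 (h₂ _ _ e₂).1⟩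

end Arithmetic

/-! ### Overrings of the biquaternion order -/

section Biquaternion

variable {F D : Type*} [Field F] [Ring D] [Algebra F D]

/-- The relations of `(a, c) ⊗ (b, d)`. -/
structure BiquaternionRel (i j i' j' : D) (a c b d : F) : Prop where
  ii : i * i = a • 1
  jj : j * j = c • 1
  ii' : i' * i' = b • 1
  jj' : j' * j' = d • 1
  ji : j * i = -(i * j)
  ji' : j' * i' = -(i' * j')
  comm_ii' : i' * i = i * i'
  comm_ji' : j * i' = i' * j
  comm_ij' : j' * i = i * j'
  comm_jj' : j' * j = j * j'

/-- The element of `F[i, i']` with coordinates `y` in the basis `1, i, i', ii'`. -/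
def biquadratic (i i' : D) (y : Fin 4 → F) : D :=
  y 0 • 1 + y 1 • i + y 2 • i' + y 3 • (i * i')

theorem mul_mul_eq_of_eq {x y z : D} (h : x * y = z) (t : D) : x * (y * t) = z * t := by
  rw [← mul_assoc, h]

theorem BiquaternionRel.mul_self_ii' {i j i' j' : D} {a c b d : F}
    (h : BiquaternionRel i j i' j' a c b d) : i * i' * (i * i') = (a * b) • 1 := by
  rw [mul_assoc, mul_mul_eq_of_eq h.comm_ii', mul_assoc i, h.ii']
  simp only [mul_smul_comm, mul_one, h.ii, smul_smul, mul_comm]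

theorem BiquaternionRel.j_mul_ii' {i j i' j' : D} {a c b d : F}
    (h : BiquaternionRel i j i' j' a c b d) : j * (i * i') = -(i * i' * j) := by
  rw [mul_mul_eq_of_eq h.ji, neg_mul, mul_assoc, h.comm_ji', mul_assoc]

variable {R : Type*} [CommRing R] [Algebra R F] [IsFractionRing R F] [Algebra R D]

/-- The arithmetic condition on `β` which makes `F[√z][√w]J ∩ Λ` integral. -/
def BiquadraticAnisotropic (β w z : R) : Prop :=
  ∀ r₀ r₁ s₀ s₁ : R, β ∣ r₀ ^ 2 + z * r₁ ^ 2 - w * (s₀ ^ 2 + z * s₁ ^ 2) →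
    β ∣ 2 * (r₀ * r₁ - w * s₀ * s₁) → β ∣ r₀ ∧ β ∣ r₁ ∧ β ∣ s₀ ∧ β ∣ s₁

/-- `I` and `J` generate a quaternion algebra over the centre `F[C]`. An element of
`F[C, I]J` which lies in `Λ` has integral coordinates. -/
theorem exists_coord_of_mul_mem {I J C : D} {w z β : R} (hβ : β ≠ 0)
    (hI : I * I = algebraMap R F w • 1) (hC : C * C = algebraMap R F z • 1)
    (hJ : J * J = algebraMap R F β • 1) (hJI : J * I = -(I * J)) (hJC : J * C = C * J)
    (hIC : I * C = C * I) {Λ : Subalgebra R D} (hJΛ : J ∈ Λ)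
    (hcoord : ∀ p₀ p₁ q₀ q₁ : F, p₀ • 1 + p₁ • C + q₀ • I + q₁ • (C * I) ∈ Λ →
      ∃ r₀ r₁ s₀ s₁ : R, algebraMap R F r₀ = p₀ ∧ algebraMap R F r₁ = p₁ ∧
        algebraMap R F s₀ = q₀ ∧ algebraMap R F s₁ = q₁)
    (H : BiquadraticAnisotropic β w z)
    {p₀ p₁ q₀ q₁ : F} (hX : (p₀ • 1 + p₁ • C + q₀ • I + q₁ • (C * I)) * J ∈ Λ) :
    ∃ r₀ r₁ s₀ s₁ : R, algebraMap R F r₀ = p₀ ∧ algebraMap R F r₁ = p₁ ∧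
        algebraMap R F s₀ = q₀ ∧ algebraMap R F s₁ = q₁ := by
  have hβ' : algebraMap R F β ≠ 0 := by simpa using hβ
  have h1 := Λ.mul_mem hX hJΛ
  have e1 : (p₀ • 1 + p₁ • C + q₀ • I + q₁ • (C * I)) * J * J =
      (algebraMap R F β * p₀) • 1 + (algebraMap R F β * p₁) • C + (algebraMap R F β * q₀) • I +
        (algebraMap R F β * q₁) • (C * I) := by
    simp only [mul_assoc, hJ]
    simp only [mul_smul_comm, mul_one]
    module
  rw [e1] at h1
  obtain ⟨r₀, r₁, s₀, s₁, h₀, h₁, h₂, h₃⟩ := hcoord _ _ _ _ h1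
  have h2 := Λ.mul_mem hX hX
  -- Write `X = P + QI` with `P, Q ∈ F[C]`. Moving `J` past `X` sends `I` to `-I`, so `(XJ)² = β(P²
  -- - wQ²)`, which lies in `F[C]`.
  have e2 : (p₀ • 1 + p₁ • C + q₀ • I + q₁ • (C * I)) * J *
      ((p₀ • 1 + p₁ • C + q₀ • I + q₁ • (C * I)) * J) =
      (algebraMap R F β * (p₀ ^ 2 + algebraMap R F z * p₁ ^ 2 -
          algebraMap R F w * (q₀ ^ 2 + algebraMap R F z * q₁ ^ 2))) • 1 +
        (algebraMap R F β * (2 * (p₀ * p₁ - algebraMap R F w * q₀ * q₁))) • C +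
        (0 : F) • I + (0 : F) • (C * I) := by
    simp only [mul_add, add_mul, smul_mul_assoc, mul_smul_comm, mul_assoc, mul_one, one_mul,
      hI, hC, hJ, hIC, mul_mul_eq_of_eq hC, mul_mul_eq_of_eq hJI, mul_mul_eq_of_eq hJC, mul_mul_eq_of_eq hIC, neg_mul, mul_neg, smul_neg,
      smul_smul]
    module
  rw [e2] at h2
  obtain ⟨t₀, t₁, -, -, k₀, k₁, -, -⟩ := hcoord _ _ _ _ h2
  have hinj := IsFractionRing.injective R F
  obtain ⟨⟨r₀, rfl⟩, ⟨r₁, rfl⟩, ⟨s₀, rfl⟩, s₁, rfl⟩ := H r₀ r₁ s₀ s₁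
    ⟨t₀, hinj (by
      simp only [map_sub, map_add, map_mul, map_pow, h₀, h₁, h₂, h₃, k₀]
      ring)⟩
    ⟨t₁, hinj (by
      simp only [map_sub, map_mul, map_ofNat, h₀, h₁, h₂, h₃, k₁]
      ring)⟩
  simp only [map_mul] at h₀ h₁ h₂ h₃
  exact ⟨r₀, r₁, s₀, s₁, mul_left_cancel₀ hβ' h₀, mul_left_cancel₀ hβ' h₁,
    mul_left_cancel₀ hβ' h₂, mul_left_cancel₀ hβ' h₃⟩

variable [IsDomain R] [IsIntegrallyClosed R] [IsScalarTower R F D]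

/-- The trace from `F[i, i']` to `F` is taken in two stages: conjugation by `j` negates `i`,
conjugation by `j'` negates `i'`. Each summand commutes with its conjugate, so integrality survives,
and the total is `4 y 0`. -/
theorem BiquaternionRel.exists_coord_zero [Nontrivial D] {i j i' j' : D} {a c b d : F}
    (h : BiquaternionRel i j i' j' a c b d) (hc : c ≠ 0) (hd : d ≠ 0) (h2 : IsUnit (2 : R))
    {y : Fin 4 → F} (hy : IsIntegral R (biquadratic i i' y)) :
    ∃ r : R, algebraMap R F r = y 0 := by
  have conj : ∀ {k : D} {e : F}, k * k = e • 1 → e ≠ 0 → ∀ {x : D}, IsIntegral R x →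
      IsIntegral R (e⁻¹ • (k * x * k)) := by
    intro k e hk he x hx
    have := hx.conj (a := e⁻¹ • k) (b := k) (by simp [hk, he]) (by simp [hk, he])
    simpa using this
  have e1 : biquadratic i i' y + c⁻¹ • (j * biquadratic i i' y * j) =
      (2 * y 0) • 1 + (2 * y 2) • i' := by
    simp only [biquadratic, mul_add, add_mul, smul_mul_assoc, mul_smul_comm, mul_assoc, mul_one,
      h.jj, h.ji, mul_mul_eq_of_eq h.ji, h.comm_ji', neg_mul]
    match_scalars <;> field_simp <;> ring
  have k1 : Commute (biquadratic i i' y) (c⁻¹ • (j * biquadratic i i' y * j)) := by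
    have : c⁻¹ • (j * biquadratic i i' y * j) =
        (2 * y 0) • 1 + (2 * y 2) • i' - biquadratic i i' y := by rw [← e1]; abel
    rw [this]
    refine Commute.sub_right (Commute.add_right ((Commute.one_right _).smul_right _) ?_) (.refl _)
    refine Commute.smul_right ?_ _
    change _ * _ = _ * _
    simp only [biquadratic, mul_add, add_mul, smul_mul_assoc, mul_smul_comm, mul_assoc, mul_one,
      one_mul, mul_mul_eq_of_eq h.comm_ii', h.comm_ii']
  have h1 := hy.add_of_commute k1 (conj h.jj hc hy)
  rw [e1] at h1
  have e2 : ((2 * y 0) • 1 + (2 * y 2) • i') +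
      d⁻¹ • (j' * ((2 * y 0) • 1 + (2 * y 2) • i') * j') =
      algebraMap F D (2 * (2 * y 0)) := by
    rw [Algebra.algebraMap_eq_smul_one]
    simp only [mul_add, add_mul, smul_mul_assoc, mul_smul_comm, mul_assoc, mul_one,
      h.jj', h.ji', neg_mul]
    match_scalars <;> field_simp <;> ring
  have k2 : Commute ((2 * y 0) • 1 + (2 * y 2) • i')
      (d⁻¹ • (j' * ((2 * y 0) • 1 + (2 * y 2) • i') * j')) := by
    rw [eq_sub_of_add_eq' e2]
    exact Commute.sub_right (Algebra.commutes _ _).symm (.refl _)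
  have h3 := h1.add_of_commute k2 (conj h.jj' hd h1)
  rw [e2] at h3
  exact exists_algebraMap_eq_of_two_mul h2 (exists_algebraMap_eq_of_two_mul h2
    (exists_algebraMap_eq_of_isIntegral h3))

/-- Multiplying by `i`, `i'` and `i'i` moves each coordinate into position 0, up to the units `u`
and `v`. -/
theorem BiquaternionRel.exists_coord [Nontrivial D] {i j i' j' : D} {c d : F} {u v : Rˣ}
    (h : BiquaternionRel i j i' j' (algebraMap R F u) c (algebraMap R F v) d)
    (hc : c ≠ 0) (hd : d ≠ 0) (h2 : IsUnit (2 : R)) {Λ : Subalgebra R D}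
    (hint : ∀ x ∈ Λ, IsIntegral R x) (hi : i ∈ Λ) (hi' : i' ∈ Λ) {y : Fin 4 → F}
    (hy : biquadratic i i' y ∈ Λ) : ∃ r : Fin 4 → R, ∀ k, algebraMap R F (r k) = y k := by
  have key : ∀ z : Fin 4 → F, biquadratic i i' z ∈ Λ → ∃ r : R, algebraMap R F r = z 0 :=
    fun z hz ↦ h.exists_coord_zero hc hd h2 (hint _ hz)
  have hmul : ∀ z : Fin 4 → F, i * biquadratic i i' z = biquadratic i i'
      ![algebraMap R F u * z 1, z 0, algebraMap R F u * z 3, z 2] := by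
    intro z
    simp only [biquadratic, mul_add, mul_smul_comm, mul_one, h.ii, mul_mul_eq_of_eq h.ii,
      smul_mul_assoc, one_mul]
    simp
    module
  have hmul' : ∀ z : Fin 4 → F, i' * biquadratic i i' z = biquadratic i i'
      ![algebraMap R F v * z 2, algebraMap R F v * z 3, z 0, z 1] := by
    intro z
    simp only [biquadratic, mul_add, mul_smul_comm, mul_one, h.ii', h.comm_ii',
      mul_mul_eq_of_eq h.comm_ii', mul_assoc]
    simp
    module
  have hy1 := Λ.mul_mem hi hy
  have hy2 := Λ.mul_mem hi' hy
  have hy3 := Λ.mul_mem hi' hy1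
  rw [hmul] at hy1
  rw [hmul'] at hy2
  rw [hmul, hmul'] at hy3
  have : ∀ k, ∃ r : R, algebraMap R F r = y k := by
    intro k
    fin_cases k
    · exact key _ hy
    · exact exists_algebraMap_eq_of_unit_mul u (by simpa using key _ hy1)
    · exact exists_algebraMap_eq_of_unit_mul v (by simpa using key _ hy2)
    · exact exists_algebraMap_eq_of_unit_mul u (exists_algebraMap_eq_of_unit_mul v (by simpa using key _ hy3))
  choose r hr using this
  exact ⟨r, hr⟩

/-- Conjugation by `i` and by `i'` preserves `Λ`, since `u` and `v` are units. The four summands of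
`x` are the simultaneous eigencomponents, recovered by signed averages since 4 is invertible, and
can be treated one at a time. -/
theorem BiquaternionRel.le_subalgebra [Nontrivial D] {i j i' j' : D} {u v : Rˣ} {π δ : R}
    (h : BiquaternionRel i j i' j' (algebraMap R F u) (algebraMap R F π) (algebraMap R F v)
      (algebraMap R F δ)) (h2 : IsUnit (2 : R)) (hπ : π ≠ 0) (hδ : δ ≠ 0)
    (H₁ : BiquadraticAnisotropic π (u : R) (v : R)) (H₂ : BiquadraticAnisotropic δ (v : R) (u : R))
    (H₃ : BiquadraticAnisotropic (π * δ) (u : R) ((u : R) * v))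
    (hspan : ∀ x : D, ∃ y₀ y₁ y₂ y₃ : Fin 4 → F, x = biquadratic i i' y₀ +
      biquadratic i i' y₁ * j + biquadratic i i' y₂ * j' + biquadratic i i' y₃ * (j * j'))
    {Γ Λ : Subalgebra R D} (hΓ : i ∈ Γ ∧ j ∈ Γ ∧ i' ∈ Γ ∧ j' ∈ Γ) (hle : Γ ≤ Λ)
    (hint : ∀ x ∈ Λ, IsIntegral R x) : Λ ≤ Γ := by
  obtain ⟨hi, hj, hi', hj'⟩ := hΓ
  have hπ' : algebraMap R F π ≠ 0 := by simpa using hπ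
  have hδ' : algebraMap R F δ ≠ 0 := by simpa using hδ
  have hcoord := fun {y} ↦ h.exists_coord hπ' hδ' h2 hint (hle hi) (hle hi') (y := y)
  have hmem : ∀ {y : Fin 4 → F}, (∃ r : Fin 4 → R, ∀ k, algebraMap R F (r k) = y k) →
      biquadratic i i' y ∈ Γ := by
    rintro y ⟨r, hr⟩
    simp only [biquadratic, ← hr, algebraMap_smul]
    exact Γ.add_mem (Γ.add_mem (Γ.add_mem (Γ.smul_mem Γ.one_mem _) (Γ.smul_mem hi _))
      (Γ.smul_mem hi' _)) (Γ.smul_mem (Γ.mul_mem hi hi') _)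
  have hu : algebraMap R F (u : R) ≠ 0 := by simp
  have hv : algebraMap R F (v : R) ≠ 0 := by simp
  have hui : (algebraMap R F (u : R))⁻¹ = algebraMap R F ↑u⁻¹ :=
    inv_eq_of_mul_eq_one_right (by rw [← map_mul]; simp)
  have hvi : (algebraMap R F (v : R))⁻¹ = algebraMap R F ↑v⁻¹ :=
    inv_eq_of_mul_eq_one_right (by rw [← map_mul]; simp)
  intro x hx
  have hA : ∀ z ∈ Λ, (algebraMap R F (u : R))⁻¹ • (i * z * i) ∈ Λ := fun z hz ↦ by
    rw [hui, algebraMap_smul]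
    exact Λ.smul_mem (Λ.mul_mem (Λ.mul_mem (hle hi) hz) (hle hi)) _
  have hB : ∀ z ∈ Λ, (algebraMap R F (v : R))⁻¹ • (i' * z * i') ∈ Λ := fun z hz ↦ by
    rw [hvi, algebraMap_smul]
    exact Λ.smul_mem (Λ.mul_mem (Λ.mul_mem (hle hi') hz) (hle hi')) _
  have hfour : ∀ z : D, (4 : F) • z ∈ Λ → z ∈ Λ := by
    intro z hz
    obtain ⟨t, ht⟩ := h2.exists_left_inv
    have : z = (t * t) • (4 : F) • z := by
      rw [← algebraMap_smul F (t * t) ((4 : F) • z), smul_smul]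
      have h4 : algebraMap R F (t * t) * 4 = 1 := by
        rw [← map_ofNat (algebraMap R F) 4, ← map_mul, ← map_one (algebraMap R F)]
        congr 1
        linear_combination (2 * t + 1) * ht
      rw [h4, one_smul]
    rw [this]
    exact Λ.smul_mem hz _
  obtain ⟨y₀, y₁, y₂, y₃, rfl⟩ := hspan x
  have ci : ∀ y : Fin 4 → F, i * biquadratic i i' y = biquadratic i i' y * i := by
    intro y
    simp only [biquadratic, mul_add, add_mul, smul_mul_assoc, mul_smul_comm, mul_one, one_mul,
      mul_assoc, h.comm_ii']
  have ci' : ∀ y : Fin 4 → F, i' * biquadratic i i' y = biquadratic i i' y * i' := by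
    intro y
    simp only [biquadratic, mul_add, add_mul, smul_mul_assoc, mul_smul_comm, mul_one, one_mul,
      mul_assoc, h.comm_ii', mul_mul_eq_of_eq h.comm_ii']
  have eA : ∀ Y₀ Y₁ Y₂ Y₃ : D, i * Y₀ = Y₀ * i → i * Y₁ = Y₁ * i → i * Y₂ = Y₂ * i →
      i * Y₃ = Y₃ * i → (algebraMap R F (u : R))⁻¹ • (i * (Y₀ + Y₁ * j + Y₂ * j' +
        Y₃ * (j * j')) * i) = Y₀ - Y₁ * j + Y₂ * j' - Y₃ * (j * j') := by
    intro Y₀ Y₁ Y₂ Y₃ c₀ c₁ c₂ c₃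
    simp only [mul_add, add_mul, mul_assoc, h.ji, h.comm_ij', mul_neg, mul_mul_eq_of_eq c₀,
      mul_mul_eq_of_eq c₁, mul_mul_eq_of_eq c₂, mul_mul_eq_of_eq c₃, mul_mul_eq_of_eq h.ji, neg_mul]
    simp only [← mul_assoc]
    simp only [mul_assoc, h.ii, smul_mul_assoc, mul_smul_comm, mul_one]
    match_scalars <;> field_simp
  have eB : ∀ Y₀ Y₁ Y₂ Y₃ : D, i' * Y₀ = Y₀ * i' → i' * Y₁ = Y₁ * i' → i' * Y₂ = Y₂ * i' →
      i' * Y₃ = Y₃ * i' → (algebraMap R F (v : R))⁻¹ • (i' * (Y₀ + Y₁ * j + Y₂ * j' +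
        Y₃ * (j * j')) * i') = Y₀ + Y₁ * j - Y₂ * j' - Y₃ * (j * j') := by
    intro Y₀ Y₁ Y₂ Y₃ c₀ c₁ c₂ c₃
    simp only [mul_add, add_mul, mul_assoc, h.ji', h.comm_ji', mul_neg, mul_mul_eq_of_eq c₀,
      mul_mul_eq_of_eq c₁, mul_mul_eq_of_eq c₂, mul_mul_eq_of_eq c₃,
      mul_mul_eq_of_eq h.comm_ji']
    simp only [← mul_assoc]
    simp only [mul_assoc, h.ii', smul_mul_assoc, mul_smul_comm, mul_one]
    match_scalars <;> field_simp
  set Y₀ := biquadratic i i' y₀ with hY₀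
  set Y₁ := biquadratic i i' y₁ with hY₁
  set Y₂ := biquadratic i i' y₂ with hY₂
  set Y₃ := biquadratic i i' y₃ with hY₃
  have xA := hA _ hx
  have xB := hB _ hx
  have xAB := hA _ xB
  rw [eA _ _ _ _ (ci _) (ci _) (ci _) (ci _)] at xA
  rw [eB _ _ _ _ (ci' _) (ci' _) (ci' _) (ci' _)] at xB xAB
  have : Y₀ + Y₁ * j - Y₂ * j' - Y₃ * (j * j') =
    Y₀ + Y₁ * j + (-Y₂) * j' + (-Y₃) * (j * j') := by noncomm_ring
  rw [this, eA _ _ _ _ (ci _) (ci _) (by rw [mul_neg, ci, neg_mul])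
    (by rw [mul_neg, ci, neg_mul])] at xAB
  have m₀ : Y₀ ∈ Λ := hfour _ <| by
    convert Λ.add_mem (Λ.add_mem (Λ.add_mem hx xA) xB) xAB using 1
    simp only [neg_mul]
    module
  have m₁ : Y₁ * j ∈ Λ := hfour _ <| by
    convert Λ.sub_mem (Λ.add_mem (Λ.sub_mem hx xA) xB) xAB using 1
    simp only [neg_mul]
    module
  have m₂ : Y₂ * j' ∈ Λ := hfour _ <| by
    convert Λ.sub_mem (Λ.sub_mem (Λ.add_mem hx xA) xB) xAB using 1
    simp only [neg_mul]
    module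
  have m₃ : Y₃ * (j * j') ∈ Λ := hfour _ <| by
    convert Λ.add_mem (Λ.sub_mem (Λ.sub_mem hx xA) xB) xAB using 1
    simp only [neg_mul]
    module
  have n₀ : Y₀ ∈ Γ := hmem (hcoord m₀)
  have n₁ : Y₁ ∈ Γ := by
    obtain ⟨r₀, r₁, s₀, s₁, e₀, e₁, f₀, f₁⟩ := exists_coord_of_mul_mem (F := F) hπ h.ii h.ii' h.jj
      h.ji h.comm_ji' h.comm_ii'.symm (hle hj) (p₀ := y₁ 0) (p₁ := y₁ 2) (q₀ := y₁ 1) (q₁ := y₁ 3)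
      (fun p₀ p₁ q₀ q₁ hp ↦ by
        obtain ⟨r, hr⟩ := hcoord (y := ![p₀, q₀, p₁, q₁]) (by
          convert hp using 1
          simp [biquadratic, h.comm_ii']
          module)
        exact ⟨r 0, r 2, r 1, r 3, hr 0, hr 2, hr 1, hr 3⟩) H₁ (by
          convert m₁ using 2
          simp only [hY₁, biquadratic, h.comm_ii']
          module)
    refine hmem ⟨![r₀, s₀, r₁, s₁], fun k ↦ ?_⟩
    fin_cases k
    exacts [e₀, f₀, e₁, f₁]
  have n₂ : Y₂ ∈ Γ := by
    obtain ⟨r₀, r₁, s₀, s₁, e₀, e₁, f₀, f₁⟩ := exists_coord_of_mul_mem (F := F) hδ h.ii' h.ii h.jj'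
      h.ji' h.comm_ij' h.comm_ii' (hle hj') (p₀ := y₂ 0) (p₁ := y₂ 1) (q₀ := y₂ 2) (q₁ := y₂ 3)
      (fun p₀ p₁ q₀ q₁ hp ↦ by
        obtain ⟨r, hr⟩ := hcoord (y := ![p₀, p₁, q₀, q₁]) (by
          convert hp using 1
          simp [biquadratic])
        exact ⟨r 0, r 1, r 2, r 3, hr 0, hr 1, hr 2, hr 3⟩) H₂ m₂
    refine hmem ⟨![r₀, r₁, s₀, s₁], fun k ↦ ?_⟩
    fin_cases k
    exacts [e₀, e₁, f₀, f₁]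
  have n₃ : Y₃ ∈ Γ := by
    have hCI : i * i' * i = algebraMap R F (u : R) • i' := by
      rw [mul_assoc, h.comm_ii', mul_mul_eq_of_eq h.ii, smul_mul_assoc, one_mul]
    -- `jj'` anticommutes with both `i` and `i'`, hence commutes with `C = ii'`, whose square is
    -- `uv`. Since `CI = ui'`, the coordinate of `i'` must be divided by `u`.
    obtain ⟨r₀, r₁, s₀, s₁, e₀, e₁, f₀, f₁⟩ := exists_coord_of_mul_mem (F := F) (I := i)
      (J := j * j') (C := i * i') (w := (u : R)) (z := (u : R) * v) (β := π * δ) (Λ := Λ)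
      (p₀ := y₃ 0) (p₁ := y₃ 3) (q₀ := y₃ 1) (q₁ := (algebraMap R F (u : R))⁻¹ * y₃ 2)
      (mul_ne_zero hπ hδ) h.ii
      (by rw [h.mul_self_ii', map_mul])
      (by
        rw [mul_assoc, mul_mul_eq_of_eq h.comm_jj', mul_assoc j, h.jj']
        simp only [mul_smul_comm, mul_one, h.jj, smul_smul, map_mul, mul_comm])
      (by rw [mul_assoc, h.comm_ij', mul_mul_eq_of_eq h.ji, neg_mul, mul_assoc])
      (by
        simp only [mul_assoc, mul_mul_eq_of_eq h.comm_ij', h.ji', mul_mul_eq_of_eq h.ji,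
          mul_mul_eq_of_eq h.comm_ji', mul_neg, neg_mul, neg_neg])
      (by rw [mul_assoc, h.comm_ii'])
      (Λ.mul_mem (hle hj) (hle hj'))
      (fun p₀ p₁ q₀ q₁ hp ↦ by
        obtain ⟨r, hr⟩ := hcoord (y := ![p₀, q₀, algebraMap R F (u : R) * q₁, p₁]) (by
          convert hp using 1
          rw [hCI]
          simp [biquadratic]
          module)
        obtain ⟨s, hs⟩ := exists_algebraMap_eq_of_unit_mul u ⟨r 2, hr 2⟩
        exact ⟨r 0, r 3, r 1, s, hr 0, hr 3, hr 1, hs⟩) H₃ (by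
          convert m₃ using 2
          rw [hCI, smul_smul, mul_right_comm, inv_mul_cancel₀ hu]
          simp only [hY₃, biquadratic]
          module)
    refine hmem ⟨![r₀, s₀, u * s₁, r₁], fun k ↦ ?_⟩
    fin_cases k
    exacts [e₀, f₀, by simp [f₁, hu], e₁]
  exact Γ.add_mem (Γ.add_mem (Γ.add_mem n₀ (Γ.mul_mem n₁ hj)) (Γ.mul_mem n₂ hj'))
    (Γ.mul_mem n₃ (Γ.mul_mem hj hj'))

end Biquaternion

/-! ### Compatibility of the standard bases -/

section Bases

theorem basisOneIJK_apply {R : Type*} [CommRing R] (a b : R) (l : Fin 4) :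
    QuaternionAlgebra.basisOneIJK a 0 b l =
      (![⟨1, 0, 0, 0⟩, ⟨0, 1, 0, 0⟩, ⟨0, 0, 1, 0⟩, ⟨0, 0, 0, 1⟩] : Fin 4 → ℍ[R,a,b]) l := by
  apply (QuaternionAlgebra.basisOneIJK a 0 b).ext_elem
  intro m
  rw [Module.Basis.repr_self, QuaternionAlgebra.coe_basisOneIJK_repr]
  fin_cases l <;> fin_cases m <;> simp

theorem quatMap_basisOneIJK {R F : Type*} [CommRing R] [Field F] [Algebra R F] (a b : R)
    (l : Fin 4) : quatMap R F a b (QuaternionAlgebra.basisOneIJK a 0 b l) =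
      QuaternionAlgebra.basisOneIJK (algebraMap R F a) 0 (algebraMap R F b) l := by
  rw [basisOneIJK_apply, basisOneIJK_apply]
  fin_cases l <;> ext <;> simp [quatMap]

end Bases

/-! ### The tensor product as a biquaternion algebra -/

section Tensor

variable {F : Type*} [Field F] {a c b d : F}

theorem biquaternionRel_tensor :
    BiquaternionRel ((⟨0, 1, 0, 0⟩ : ℍ[F,a,c]) ⊗ₜ[F] (1 : ℍ[F,b,d]))
      ((⟨0, 0, 1, 0⟩ : ℍ[F,a,c]) ⊗ₜ[F] (1 : ℍ[F,b,d]))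
      ((1 : ℍ[F,a,c]) ⊗ₜ[F] (⟨0, 1, 0, 0⟩ : ℍ[F,b,d]))
      ((1 : ℍ[F,a,c]) ⊗ₜ[F] (⟨0, 0, 1, 0⟩ : ℍ[F,b,d])) a c b d := by
  have ii : ∀ x y : F, (⟨0, 1, 0, 0⟩ : ℍ[F,x,y]) * ⟨0, 1, 0, 0⟩ = x • 1 := by
    intro x y; ext <;> simp
  have jj : ∀ x y : F, (⟨0, 0, 1, 0⟩ : ℍ[F,x,y]) * ⟨0, 0, 1, 0⟩ = y • 1 := by
    intro x y; ext <;> simp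
  have ji : ∀ x y : F, (⟨0, 0, 1, 0⟩ : ℍ[F,x,y]) * ⟨0, 1, 0, 0⟩ =
      -(⟨0, 1, 0, 0⟩ * ⟨0, 0, 1, 0⟩) := by
    intro x y; ext <;> simp
  constructor <;> simp only [Algebra.TensorProduct.tmul_mul_tmul, mul_one, one_mul,
    Algebra.TensorProduct.one_def, ← TensorProduct.smul_tmul', TensorProduct.tmul_smul,
    TensorProduct.neg_tmul, TensorProduct.tmul_neg, ii, jj, ji]

theorem exists_biquadratic_tensor (x : ℍ[F,a,c] ⊗[F] ℍ[F,b,d]) :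
    ∃ y₀ y₁ y₂ y₃ : Fin 4 → F, x =
      biquadratic ((⟨0, 1, 0, 0⟩ : ℍ[F,a,c]) ⊗ₜ[F] (1 : ℍ[F,b,d]))
        ((1 : ℍ[F,a,c]) ⊗ₜ[F] (⟨0, 1, 0, 0⟩ : ℍ[F,b,d])) y₀ +
      biquadratic ((⟨0, 1, 0, 0⟩ : ℍ[F,a,c]) ⊗ₜ[F] (1 : ℍ[F,b,d]))
        ((1 : ℍ[F,a,c]) ⊗ₜ[F] (⟨0, 1, 0, 0⟩ : ℍ[F,b,d])) y₁ *
          ((⟨0, 0, 1, 0⟩ : ℍ[F,a,c]) ⊗ₜ[F] (1 : ℍ[F,b,d])) +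
      biquadratic ((⟨0, 1, 0, 0⟩ : ℍ[F,a,c]) ⊗ₜ[F] (1 : ℍ[F,b,d]))
        ((1 : ℍ[F,a,c]) ⊗ₜ[F] (⟨0, 1, 0, 0⟩ : ℍ[F,b,d])) y₂ *
          ((1 : ℍ[F,a,c]) ⊗ₜ[F] (⟨0, 0, 1, 0⟩ : ℍ[F,b,d])) +
      biquadratic ((⟨0, 1, 0, 0⟩ : ℍ[F,a,c]) ⊗ₜ[F] (1 : ℍ[F,b,d]))
        ((1 : ℍ[F,a,c]) ⊗ₜ[F] (⟨0, 1, 0, 0⟩ : ℍ[F,b,d])) y₃ *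
          (((⟨0, 0, 1, 0⟩ : ℍ[F,a,c]) ⊗ₜ[F] (1 : ℍ[F,b,d])) *
            ((1 : ℍ[F,a,c]) ⊗ₜ[F] (⟨0, 0, 1, 0⟩ : ℍ[F,b,d]))) := by
  have hadd : ∀ (i i' : ℍ[F,a,c] ⊗[F] ℍ[F,b,d]) (y z : Fin 4 → F),
      biquadratic i i' (y + z) = biquadratic i i' y + biquadratic i i' z := by
    intro i i' y z
    simp only [biquadratic, Pi.add_apply]
    module
  induction x with
  | zero => exact ⟨0, 0, 0, 0, by simp [biquadratic]⟩
  | add x x' hx hx' =>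
    obtain ⟨y₀, y₁, y₂, y₃, rfl⟩ := hx
    obtain ⟨z₀, z₁, z₂, z₃, rfl⟩ := hx'
    refine ⟨y₀ + z₀, y₁ + z₁, y₂ + z₂, y₃ + z₃, ?_⟩
    simp only [hadd, add_mul]
    abel
  | tmul q r =>
    refine ⟨![q.re * r.re, q.imI * r.re, q.re * r.imI, q.imI * r.imI],
      ![q.imJ * r.re, q.imK * r.re, q.imJ * r.imI, q.imK * r.imI],
      ![q.re * r.imJ, q.imI * r.imJ, q.re * r.imK, q.imI * r.imK],
      ![q.imJ * r.imJ, q.imK * r.imJ, q.imJ * r.imK, q.imK * r.imK], ?_⟩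
    have hk : (⟨0, 1, 0, 0⟩ : ℍ[F,a,c]) * ⟨0, 0, 1, 0⟩ = ⟨0, 0, 0, 1⟩ := by ext <;> simp
    have hk' : (⟨0, 1, 0, 0⟩ : ℍ[F,b,d]) * ⟨0, 0, 1, 0⟩ = ⟨0, 0, 0, 1⟩ := by ext <;> simp
    have hq : q = q.re • 1 + q.imI • ⟨0, 1, 0, 0⟩ + q.imJ • ⟨0, 0, 1, 0⟩ +
      q.imK • ⟨0, 0, 0, 1⟩ := by ext <;> simp
    have hr : r = r.re • 1 + r.imI • ⟨0, 1, 0, 0⟩ + r.imJ • ⟨0, 0, 1, 0⟩ +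
      r.imK • ⟨0, 0, 0, 1⟩ := by ext <;> simp
    conv_lhs => rw [hq, hr]
    simp only [biquadratic, add_mul, smul_mul_assoc, Algebra.TensorProduct.tmul_mul_tmul, mul_one,
      one_mul, hk, hk', Algebra.TensorProduct.one_def, TensorProduct.add_tmul,
      TensorProduct.tmul_add, TensorProduct.tmul_smul, ← TensorProduct.smul_tmul',
      Matrix.cons_val]
    module

/-- If `e = w²` then `(i - w)(i + w) = 0` forces `i` to be a scalar; but a scalar commutes with `j`,
so `2ij = 0`, which is impossible. -/
theorem not_isSquare_of_anticommute {D : Type*} [Ring D] [Algebra F D] [Nontrivial D]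
    [NoZeroDivisors D] (h2 : (2 : F) ≠ 0) {i j : D} {e f : F} (hi : i * i = e • 1)
    (hj : j * j = f • 1) (hf : f ≠ 0) (hji : j * i = -(i * j)) (he : e ≠ 0) : ¬ IsSquare e := by
  have hne : ∀ x : D, x + x = 0 → x = 0 := by
    intro x hx
    have : (2 : F) • x = 0 := by rw [two_smul, hx]
    have h3 := congrArg (fun z ↦ (2 : F)⁻¹ • z) this
    simpa [smul_smul, h2] using h3
  have hj0 : j ≠ 0 := by
    rintro rfl
    rw [mul_zero, eq_comm, smul_eq_zero] at hj
    simp [hf] at hj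
  have hi0 : i ≠ 0 := by
    rintro rfl
    rw [mul_zero, eq_comm, smul_eq_zero] at hi
    simp [he] at hi
  have hscalar : ∀ w : F, i ≠ w • 1 := by
    rintro w rfl
    have : j * (w • 1) + j * (w • 1) = 0 := by
      nth_rw 2 [hji]
      simp
    exact (mul_ne_zero hj0 hi0) (hne _ this)
  rintro ⟨w, rfl⟩
  have : (i - w • 1) * (i - (-w) • 1) = 0 := by
    simp only [mul_sub, sub_mul, hi, smul_mul_assoc, mul_smul_comm, mul_one, one_mul]
    module
  rcases mul_eq_zero.1 this with h | h
  · exact hscalar _ (sub_eq_zero.1 h)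
  · exact hscalar _ (sub_eq_zero.1 h)

end Tensor

/-! ### Divisibility conditions for the biquaternion case -/

section Arithmetic

variable {R : Type*} [CommRing R]

theorem biquadraticAnisotropic_of_prime (h2 : IsUnit (2 : R)) {p w z : R} (hp : Prime p)
    (hw : AnisotropicMod (Ideal.span {p}) w) (hz : AnisotropicMod (Ideal.span {p}) z)
    (hwz : AnisotropicMod (Ideal.span {p}) (w * z)) : BiquadraticAnisotropic p w z := by
  intro r₀ r₁ s₀ s₁ h₁ h₂
  have : (Ideal.span {p}).IsPrime := (Ideal.span_singleton_prime hp.ne_zero).2 hp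
  simp only [← Ideal.mem_span_singleton] at h₁ h₂ ⊢
  exact AnisotropicMod.biquadratic h2 hw hz hwz h₁ h₂

theorem BiquadraticAnisotropic.mul [IsDomain R] {π δ w z : R} (hδ : Prime δ) (h : ¬ δ ∣ π)
    (h₁ : BiquadraticAnisotropic π w z) (h₂ : BiquadraticAnisotropic δ w z) :
    BiquadraticAnisotropic (π * δ) w z := by
  intro r₀ r₁ s₀ s₁ e f
  obtain ⟨a₀, a₁, b₀, b₁⟩ := h₁ r₀ r₁ s₀ s₁ ((dvd_mul_right _ _).trans e)
    ((dvd_mul_right _ _).trans f)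
  obtain ⟨c₀, c₁, d₀, d₁⟩ := h₂ r₀ r₁ s₀ s₁ ((dvd_mul_left _ _).trans e)
    ((dvd_mul_left _ _).trans f)
  exact ⟨mul_dvd_of_prime hδ h a₀ c₀, mul_dvd_of_prime hδ h a₁ c₁, mul_dvd_of_prime hδ h b₀ d₀,
    mul_dvd_of_prime hδ h b₁ d₁⟩

theorem AnisotropicMod.sq_mul {A : Type*} [CommRing A] {I : Ideal A} {w s : A} (hs : IsUnit s)
    (h : AnisotropicMod I w) : AnisotropicMod I (s ^ 2 * w) := by
  intro b c hbc
  obtain ⟨hb, hc⟩ := h b (s * c) (by convert hbc using 1; ring)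
  exact ⟨hb, (Ideal.unit_mul_mem_iff_mem _ hs).1 hc⟩

end Arithmetic

/-! ### Assembling the cases -/

section Main

variable {R F Γ₀ : Type*} [CommRing R] [IsDomain R] [HenselianLocalRing R] [IsNoetherianRing R]
  [Field F] [Algebra R F] [IsFractionRing R F] [Ring Γ₀] [Algebra R Γ₀] [IsAzumaya R Γ₀]
  [IsIntegrallyClosed R]

theorem tensorIsMaximalOrder_quatMap (h2 : IsUnit (2 : R)) {a b : R} (ha : a ≠ 0) (hb : b ≠ 0)
    (H : NoZeroDivisors ℍ[F,algebraMap R F a,algebraMap R F b] → ∀ r₁ r₂ r₃ : R,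
      a * b ∣ b * r₁ ^ 2 + a * r₂ ^ 2 - r₃ ^ 2 → a ∣ r₁ ∧ b ∣ r₂ ∧ a * b ∣ r₃) :
    TensorIsMaximalOrder R F Γ₀ (quatMap R F a b) :=
  tensorIsMaximalOrder_of_forall_le_range _ _ _ (quatMap_basisOneIJK a b)
    fun hD Λ hle hint ↦ le_range_quatMap h2 ha hb (H hD) Λ hle hint

theorem tensorIsMaximalOrder_quatMap_unit (h2 : IsUnit (2 : R)) (u : Rˣ) {b : R} (hb : b ≠ 0)
    (H : AnisotropicMod (maximalIdeal R) (u : R) → AnisotropicMod (Ideal.span {b}) (u : R)) :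
    TensorIsMaximalOrder R F Γ₀ (quatMap R F (u : R) b) := by
  refine tensorIsMaximalOrder_quatMap h2 u.ne_zero hb fun hD ↦ ?_
  refine AnisotropicMod.dvd_of_isUnit u.isUnit (H ?_)
  refine anisotropicMod_maximalIdeal h2 u.isUnit fun hsq ↦ ?_
  exact not_isSquare_of_noZeroDivisors (b := algebraMap R F b) (hsq.map (algebraMap R F))

theorem tensorIsMaximalOrder_tensorMap_quatMap (h2 : IsUnit (2 : R)) (u v : Rˣ) {π δ : R}
    (hπ : π ≠ 0) (hδ : δ ≠ 0)
    (H : AnisotropicMod (maximalIdeal R) (u : R) → AnisotropicMod (maximalIdeal R) (v : R) →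
      AnisotropicMod (maximalIdeal R) ((u : R) * v) → BiquadraticAnisotropic π (u : R) (v : R) ∧
      BiquadraticAnisotropic δ (v : R) (u : R) ∧
      BiquadraticAnisotropic (π * δ) (u : R) ((u : R) * v)) :
    TensorIsMaximalOrder R F Γ₀
      (tensorMap (F := F) (quatMap R F (u : R) π) (quatMap R F (v : R) δ)) := by
  refine tensorIsMaximalOrder_of_forall_le_range
    ((QuaternionAlgebra.basisOneIJK _ 0 _).tensorProduct (QuaternionAlgebra.basisOneIJK _ 0 _))
    ((QuaternionAlgebra.basisOneIJK _ 0 _).tensorProduct (QuaternionAlgebra.basisOneIJK _ 0 _))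
    _ ?_ ?_
  · rintro ⟨k, l⟩
    simp only [Module.Basis.tensorProduct_apply, tensorMap_tmul, quatMap_basisOneIJK]
  intro hD Λ hle hint
  have hrel := biquaternionRel_tensor (a := algebraMap R F u) (c := algebraMap R F π)
    (b := algebraMap R F v) (d := algebraMap R F δ)
  have hu : algebraMap R F (u : R) ≠ 0 := by simp
  have hv : algebraMap R F (v : R) ≠ 0 := by simp
  have hπ' : algebraMap R F π ≠ 0 := by simpa using hπ
  have hδ' : algebraMap R F δ ≠ 0 := by simpa using hδ
  have h2F : (2 : F) ≠ 0 := by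
    rw [← map_ofNat (algebraMap R F) 2]
    exact (h2.map (algebraMap R F)).ne_zero
  have : Nontrivial (ℍ[F,algebraMap R F u,algebraMap R F π] ⊗[F]
      ℍ[F,algebraMap R F v,algebraMap R F δ]) := by
    have : Nontrivial ℍ[F,algebraMap R F u,algebraMap R F π] :=
      ⟨0, 1, fun h ↦ by simpa using congrArg QuaternionAlgebra.re h⟩
    have : Nontrivial ℍ[F,algebraMap R F v,algebraMap R F δ] :=
      ⟨0, 1, fun h ↦ by simpa using congrArg QuaternionAlgebra.re h⟩
    infer_instance
  have aniso : ∀ w : R, IsUnit w → ¬ IsSquare (algebraMap R F w) →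
      AnisotropicMod (maximalIdeal R) w := fun w hw hsq ↦
    anisotropicMod_maximalIdeal h2 hw fun h ↦ hsq (h.map (algebraMap R F))
  obtain ⟨H₁, H₂, H₃⟩ := H
    (aniso _ u.isUnit (not_isSquare_of_anticommute h2F hrel.ii hrel.jj hπ' hrel.ji hu))
    (aniso _ v.isUnit (not_isSquare_of_anticommute h2F hrel.ii' hrel.jj' hδ' hrel.ji' hv))
    (aniso _ (u.isUnit.mul v.isUnit) (by
      rw [map_mul]
      exact not_isSquare_of_anticommute h2F hrel.mul_self_ii' hrel.jj hπ' hrel.j_mul_ii'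
        (mul_ne_zero hu hv)))
  refine hrel.le_subalgebra h2 hπ hδ H₁ H₂ H₃ exists_biquadratic_tensor
    ⟨⟨⟨0, 1, 0, 0⟩ ⊗ₜ 1, ?_⟩, ⟨⟨0, 0, 1, 0⟩ ⊗ₜ 1, ?_⟩, ⟨1 ⊗ₜ ⟨0, 1, 0, 0⟩, ?_⟩,
      ⟨1 ⊗ₜ ⟨0, 0, 1, 0⟩, ?_⟩⟩ hle hint
  all_goals
    refine (tensorMap_tmul _ _ _ _).trans ?_
    rw [map_one]
    congr 1
    ext <;> simp [quatMap]

end Main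

end MaxOrd

open IsLocalRing MaxOrd in
theorem mainTheorem10
    {R F Γ₀ : Type*} [CommRing R] [IsRegularLocalRing R]
    [IsAdicComplete (IsLocalRing.maximalIdeal R) R]
    (hdim : ringKrullDim R = 2)
    (hchar : ringChar (IsLocalRing.ResidueField R) ≠ 2)
    [Field F] [Algebra R F] [IsFractionRing R F]
    (π δ : R) (hm : IsLocalRing.maximalIdeal R = Ideal.span {π, δ})
    [Ring Γ₀] [Algebra R Γ₀] [IsAzumaya R Γ₀]
    (u v : Rˣ) :
    MaxOrd.TensorIsMaximalOrder R F Γ₀ (MaxOrd.quatMap R F (u : R) (v : R)) ∧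
    MaxOrd.TensorIsMaximalOrder R F Γ₀ (MaxOrd.quatMap R F (u : R) π) ∧
    MaxOrd.TensorIsMaximalOrder R F Γ₀ (MaxOrd.quatMap R F π δ) ∧
    MaxOrd.TensorIsMaximalOrder R F Γ₀ (MaxOrd.quatMap R F (u : R) (π * δ)) ∧
    MaxOrd.TensorIsMaximalOrder R F Γ₀
      (MaxOrd.tensorMap (F := F) (MaxOrd.quatMap R F (u : R) π)
        (MaxOrd.quatMap R F (v : R) δ)) := by
  have hdom : IsDomain R := (IsFractionRing.injective R F).isDomain (algebraMap R F)
  -- Completeness enters only here, through Hensel's lemma.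
  have hhens : HenselianLocalRing R :=
    ⟨fun f hf a h₁ h₂ ↦ HenselianRing.is_henselian f hf a h₁ (h₂.map _)⟩
  have h2 := isUnit_two_of_ringChar_residueField_ne_two hchar
  have hm' : maximalIdeal R = Ideal.span {δ, π} := by rw [hm, Set.pair_comm]
  have := uniqueFactorizationMonoid_of_dim_two hdim hm
  have hπ := prime_of_dim_two hdim hm
  have hδ := prime_of_dim_two hdim hm'
  have hδπ : ¬ δ ∣ π := fun h ↦ pow_not_mem_span_of_dim_two hdim hm' 1
    (by rwa [pow_one, Ideal.mem_span_singleton])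
  have toπ : ∀ {w : R}, AnisotropicMod (maximalIdeal R) w → AnisotropicMod (Ideal.span {π}) w :=
    fun h ↦ h.span_of_maximalIdeal hdim hm
  have toδ : ∀ {w : R}, AnisotropicMod (maximalIdeal R) w → AnisotropicMod (Ideal.span {δ}) w :=
    fun h ↦ h.span_of_maximalIdeal hdim hm'
  refine ⟨?_, ?_, ?_, ?_, ?_⟩
  · exact tensorIsMaximalOrder_quatMap h2 u.ne_zero v.ne_zero fun _ r₁ r₂ r₃ _ ↦
      ⟨u.isUnit.dvd, v.isUnit.dvd, (u.isUnit.mul v.isUnit).dvd⟩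
  · exact tensorIsMaximalOrder_quatMap_unit h2 u hπ.ne_zero toπ
  · exact tensorIsMaximalOrder_quatMap h2 hπ.ne_zero hδ.ne_zero fun _ ↦
      dvd_of_anisotropicMod_params hδ hδπ (anisotropicMod_span_of_dim_two hdim hm)
        (anisotropicMod_span_of_dim_two hdim hm')
  · exact tensorIsMaximalOrder_quatMap_unit h2 u (mul_ne_zero hπ.ne_zero hδ.ne_zero)
      fun h ↦ (toπ h).mul hδ hδπ (toδ h)
  · refine tensorIsMaximalOrder_tensorMap_quatMap h2 u v hπ.ne_zero hδ.ne_zero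
      fun hu hv huv ↦ ?_
    -- The summand `Ljj'` has `w = u` and `z = uv`, so `wz = u²v`, which differs from `v` by a unit
    -- square.
    have huuv : AnisotropicMod (maximalIdeal R) ((u : R) * (u * v)) := by
      rw [← mul_assoc, ← sq]
      exact hv.sq_mul u.isUnit
    exact ⟨biquadraticAnisotropic_of_prime h2 hπ (toπ hu) (toπ hv) (toπ huv),
      biquadraticAnisotropic_of_prime h2 hδ (toδ hv) (toδ hu) (mul_comm (u : R) v ▸ toδ huv),
      (biquadraticAnisotropic_of_prime h2 hπ (toπ hu) (toπ huv) (toπ huuv)).mul hδ hδπ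
        (biquadraticAnisotropic_of_prime h2 hδ (toδ hu) (toδ huv) (toδ huuv))⟩
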